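/- Consider the lattice graph $\mathbb{Z}^2$, where $n(v)$ denotes the set of the four neighbours of $v$. A \emph{state} is a function $\phi:\mathbb{Z}^2\to\mathbb{Z}_{\ge 0}$; it is \emph{stable} if $\phi<4$ everywhere. A \emph{toppling} at $v$, legal if $\phi(v)\ge 4$, decreases $\phi(v)$ by $4$ and increases $\phi$ by $1$ at each vertex of $n(v)$. A \emph{relaxation} of $\phi$ is a finite or infinite sequence of legal topplings starting from $\phi$; a state is \emph{relaxable} if it has a relaxation whose states stabilize at every vertex and whose pointwise limit is stable, and this limit is the \emph{result} of the relaxation. A \emph{territory} of a stable state $\phi$ is a connected component, with at least two vertices, of the subgraph induced on $\{\phi=3\}$. Let $v$ be a vertex of a territory $\mathcal{T}$ of $\phi$ such that $\phi+\delta_v$ is relaxable. Add a grain at $v$, topple $v$, topple each unstable vertex of $n(v)\cap\mathcal{T}$, and then remove one grain from $v$; the result of the relaxation of the state so obtained is $W_v\phi$, the result of sending a wave from $v$. We write $W_{\mathcal{T}}\phi=\psi$ if, for every $v\in\mathcal{T}$, the state $\phi+\delta_v$ is relaxable and $W_v\phi=\psi$. For $\alpha\in\mathbb{P}\mathbb{Q}^1$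 let $(p,q)$ be a primitive integer vector with $[p:q]=\alpha$, let $L_\alpha\subset\mathbb{R}^2$ be the line through the origin spanned by $(p,q)$, put $F(x,y)=qx-py$, and let $(p',q')$ be an integer vector with $F(p',q')=1$. \textbf{Theorem.} For every $\alpha\in\mathbb{P}\mathbb{Q}^1$ there is a sand soliton in the direction $\alpha$, that is, a stable state $\phi$ on $\mathbb{Z}^2$ such that, for each choice of $(p,q)$ and $(p',q')$ as above, \begin{itemize} \item $\phi(-v)=\phi(v)$ and $\phi(v+(p,q))=\phi(v)$ for all $v\in\mathbb{Z}^2$; \item the set $\{v:\phi(v)<3\}$ is contained in a tubular neighbourhood of $L_\alpha$ of finite radius, and the subgraph induced on $\{v:\phi(v)=3\}$ has exactly two infinite connected components, $\mathcal{T}$ and $-\mathcal{T}$, with $F>0$ on $\mathcal{T}$ and $F<0$ on $-\mathcal{T}$; \item $W_{\mathcal{T}}\phi(v)=\phi(v-(p',q'))$ and $W_{-\mathcal{T}}\phi(v)=\phi(v+(p',q'))$ for all $v\in\mathbb{Z}^2$. \end{itemize} -/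

import Mathlib

namespace Sandpile

open scoped Pointwise

/-- The four neighbours `n(v)` of a vertex of the lattice `ℤ²`. -/
def nbrs (v : ℤ × ℤ) : Finset (ℤ × ℤ) :=
  {(v.1 + 1, v.2), (v.1 - 1, v.2), (v.1, v.2 + 1), (v.1, v.2 - 1)}

/-- The lattice graph on `ℤ²`. -/
def lattice : SimpleGraph (ℤ × ℤ) where
  Adj v w := w ∈ nbrs v
  symm := ⟨by
    rintro ⟨a, b⟩ ⟨c, d⟩ h
    simp only [nbrs, Finset.mem_insert, Finset.mem_singleton, Prod.mk.injEq] at h ⊢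
    omega⟩
  loopless := ⟨by
    rintro ⟨a, b⟩ h
    simp only [nbrs, Finset.mem_insert, Finset.mem_singleton, Prod.mk.injEq] at h
    omega⟩

/-- A state: a non-negative integer-valued function on `ℤ²`. -/
def IsState (φ : ℤ × ℤ → ℤ) : Prop := ∀ v, 0 ≤ φ v

/-- A stable state. -/
def IsStable (φ : ℤ × ℤ → ℤ) : Prop := IsState φ ∧ ∀ v, φ v < 4

/-- The toppling `T_v`. -/
def topple (v : ℤ × ℤ) (φ : ℤ × ℤ → ℤ) : ℤ × ℤ → ℤ := fun w =>
  if w = v then φ w - 4 else if v ∈ nbrs w then φ w + 1 else φ w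

/-- A relaxation of `φ`: a finite or infinite sequence of legal topplings starting at `φ`.
Idle steps are allowed, so that a finite sequence is one that is eventually idle. -/
def IsRelaxation (φ : ℤ × ℤ → ℤ) (ψ : ℕ → ℤ × ℤ → ℤ) : Prop :=
  ψ 0 = φ ∧ ∀ i, ψ (i + 1) = ψ i ∨ ∃ v, 4 ≤ ψ i v ∧ ψ (i + 1) = topple v (ψ i)

/-- `φ'` is the result of a stabilizing (locally finite) relaxation of the state `φ`. -/
def RelaxesTo (φ φ' : ℤ × ℤ → ℤ) : Prop :=
  IsState φ ∧ IsStable φ' ∧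
    ∃ ψ, IsRelaxation φ ψ ∧ ∀ v, ∃ N, ∀ i, N ≤ i → ψ i v = φ' v

/-- A state that has a stabilizing relaxation. -/
def Relaxable (φ : ℤ × ℤ → ℤ) : Prop := ∃ φ', RelaxesTo φ φ'

/-- A territory of `φ`: a connected component, with at least two elements, of `{φ = 3}`. -/
structure IsTerritory (φ : ℤ × ℤ → ℤ) (T : Set (ℤ × ℤ)) : Prop where
  connected : (lattice.induce T).Connected
  eq_three : ∀ v ∈ T, φ v = 3
  lt_three : ∀ w, w ∉ T → (∃ v ∈ nbrs w, v ∈ T) → φ w < 3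
  nontrivial : T.Nontrivial

open Classical in
/-- The state from which a wave at `v ∈ T` is relaxed: add a grain at `v`, topple `v`, topple every
unstable vertex of `n(v) ∩ T`, and remove a grain from `v`. -/
noncomputable def waveStart (φ : ℤ × ℤ → ℤ) (T : Set (ℤ × ℤ)) (v : ℤ × ℤ) : ℤ × ℤ → ℤ :=
  let φ₁ := topple v (φ + Pi.single v 1)
  let A := (nbrs v).filter fun u => u ∈ T ∧ 4 ≤ φ₁ u
  let φ₂ := φ₁ + ∑ u ∈ A, (topple u φ₁ - φ₁)
  φ₂ - Pi.single v 1

/-- `W_T φ` is defined and equals `φ'`: for every `v` in the territory `T` the state `φ + δ_v` is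
relaxable and the wave sent from `v` results in `φ'`. -/
def WaveEq (φ : ℤ × ℤ → ℤ) (T : Set (ℤ × ℤ)) (φ' : ℤ × ℤ → ℤ) : Prop :=
  IsTerritory φ T ∧ ∀ v ∈ T, Relaxable (φ + Pi.single v 1) ∧ RelaxesTo (waveStart φ T v) φ'

/-- The linear form `F_{p,q}(x,y) = q x - p y`. -/
def form (p q : ℤ) (v : ℤ × ℤ) : ℤ := q * v.1 - p * v.2

/-- A lattice vertex as a point of the Euclidean plane. -/
noncomputable def toPlane (v : ℤ × ℤ) : EuclideanSpace ℝ (Fin 2) := !₂[(v.1 : ℝ), (v.2 : ℝ)]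

/-- The line through the origin spanned by `(p,q)`. -/
noncomputable def line (p q : ℤ) : Set (EuclideanSpace ℝ (Fin 2)) :=
  (Submodule.span ℝ {toPlane (p, q)} : Submodule ℝ (EuclideanSpace ℝ (Fin 2)))

/-- `(p,q)` is a primitive integer vector on the rational line `α`. -/
def IsPrimitiveVector (α : Projectivization ℚ (ℚ × ℚ)) (p q : ℤ) : Prop :=
  IsCoprime p q ∧ ((p : ℚ), (q : ℚ)) ∈ α.submodule

/-- Every rational direction contains a primitive vector. -/
theorem exists_isPrimitiveVector (α : Projectivization ℚ (ℚ × ℚ)) :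
    ∃ p q, IsPrimitiveVector α p q := by
  obtain ⟨⟨a, b⟩, hv, rfl⟩ : ∃ v, ∃ hv : v ≠ 0, Projectivization.mk ℚ v hv = α :=
    ⟨α.rep, α.rep_nonzero, α.mk_rep⟩
  have hne : a.num * b.den ≠ 0 ∨ b.num * a.den ≠ 0 := by
    by_contra h
    push Not at h
    apply hv
    have ha : a.num = 0 := by simpa using h.1
    have hb : b.num = 0 := by simpa using h.2
    simp [Rat.num_eq_zero.1 ha, Rat.num_eq_zero.1 hb]
  have hg : Int.gcd (a.num * b.den) (b.num * a.den) ≠ 0 := by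
    rw [Ne, Int.gcd_eq_zero_iff]
    tauto
  obtain ⟨x', hx⟩ := Int.gcd_dvd_left (a.num * b.den) (b.num * a.den)
  obtain ⟨y', hy⟩ := Int.gcd_dvd_right (a.num * b.den) (b.num * a.den)
  refine ⟨x', y', ?_, ?_⟩
  · have h1 := Int.isCoprime_iff_gcd_eq_one.2
      (Int.gcd_div_gcd_div_gcd (Nat.pos_of_ne_zero hg))
    have e1 : a.num * b.den / (Int.gcd (a.num * b.den) (b.num * a.den) : ℤ) = x' :=
      Int.ediv_eq_of_eq_mul_right (by exact_mod_cast hg) hx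
    have e2 : b.num * a.den / (Int.gcd (a.num * b.den) (b.num * a.den) : ℤ) = y' :=
      Int.ediv_eq_of_eq_mul_right (by exact_mod_cast hg) hy
    rwa [e1, e2] at h1
  · rw [Projectivization.submodule_mk, Submodule.mem_span_singleton]
    generalize Int.gcd (a.num * b.den) (b.num * a.den) = g at hx hy hg
    refine ⟨(a.den : ℚ) * b.den / g, ?_⟩
    have hg' : (g : ℚ) ≠ 0 := by exact_mod_cast hg
    have hx' : (a.num : ℚ) * b.den = g * x' := by exact_mod_cast hx
    have hy' : (b.num : ℚ) * a.den = g * y' := by exact_mod_cast hy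
    have ha := Rat.mul_den_eq_num a
    have hb := Rat.mul_den_eq_num b
    simp only [Prod.smul_mk, smul_eq_mul, Prod.mk.injEq]
    constructor
    · field_simp
      rw [← ha] at hx'
      linear_combination hx'
    · field_simp
      rw [← hb] at hy'
      linear_combination hy'

/-- `φ` is a sand soliton in the direction `α`. The conditions are required for each of the two
primitive vectors `(p,q)` of `α` and for every choice of `(p',q')` with `F_{p,q}(p',q') = 1`. -/
structure IsSandSoliton (α : Projectivization ℚ (ℚ × ℚ)) (φ : ℤ × ℤ → ℤ) : Prop where
  stable : IsStable φ
  symmetric : ∀ v, φ (-v) = φ v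
  periodic : ∀ p q, IsPrimitiveVector α p q → ∀ v, φ (v + (p, q)) = φ v
  strip : ∀ p q, IsPrimitiveVector α p q →
    ∃ R : ℝ, ∀ v, φ v < 3 → toPlane v ∈ Metric.thickening R (line p q)
  /-- There are exactly two infinite components `T`, `-T` of `{φ = 3}`, separated by the sign of
  `F`, and the waves sent from them translate `φ` by `(p',q')` and `-(p',q')`. -/
  wave : ∀ p q, IsPrimitiveVector α p q → ∃ T : Set (ℤ × ℤ),
    IsTerritory φ T ∧ T.Infinite ∧ IsTerritory φ (-T) ∧
    (∀ T', IsTerritory φ T' → T'.Infinite → T' = T ∨ T' = -T) ∧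
    (∀ v ∈ T, 0 < form p q v) ∧ (∀ v ∈ -T, form p q v < 0) ∧
    ∀ p' q', form p q (p', q') = 1 →
      WaveEq φ T (fun v => φ (v - (p', q'))) ∧ WaveEq φ (-T) (fun v => φ (v + (p', q')))

end Sandpile

namespace Sandpile

open scoped Pointwise

/-! Write F for `form p q`. The soliton is φ = 3 + Δ(θ ∘ F), where θ is the least integer-valued
superharmonic function of the level that equals min(0, k) far from level zero (`IsProfile`,
`levelState`). Minimality of θ drives the whole argument. Lowering θ at a single level shows that
its Laplacian is at least -3. Comparing θ with its translates and with θ(-k) + k gives slopes zero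
or one and the central symmetry. Existence (`exists_isProfile`) rests on a uniform bound for the
region where a superharmonic function with such slopes differs from min(0, k)
(`exists_support_bound`): the total mass of its Laplacian is bounded, and a long window without mass
forces the function to be k on the whole left of it or 0 on the whole right.

Waves: H = θ(F - 1) + 1 - θ(F) takes the values 0 and 1, and φ + ΔH is φ translated by one level. By
the least action principle (`exists_relaxation`) the wave topples at most H, and it topples every
vertex of the territory once. The minimum over each level of its toppling function, added to θ, is
superharmonic and at least min(1, k) far away, hence at least θ(k - 1) + 1 (`IsProfile.wave_le`). So
the toppling function is H.

Components: a further infinite component of {φ = 3} would stay in a strip and so contain two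
vertices on one level. A path joining them closes up modulo (p, q), and its crossing numbers with
horizontal rays show that the levels of the component separate -∞ from +∞ (`isBarrier_levels`). As θ
is harmonic on these levels, it is k below one of them or 0 above one of them
(`IsProfile.barrier_cases`). Then the component runs out of the strip, a contradiction
(`IsProfile.eq_of_infinite`). -/

/-- The Laplacian of `ℤ²` on functions of the level `form p q`. -/
def levelLap (p q : ℤ) (g : ℤ → ℤ) (k : ℤ) : ℤ :=
  g (k + p) + g (k - p) + g (k + q) + g (k - q) - 4 * g k

/-- The function `θ` is the least superharmonic function of the level that agrees with
`min 0 k` far from the level zero. -/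
structure IsProfile (p q : ℤ) (θ : ℤ → ℤ) : Prop where
  superharmonic : ∀ k, levelLap p q θ k ≤ 0
  eventually_eq : ∃ R, ∀ k, R ≤ |k| → θ k = min 0 k
  le : ∀ g : ℤ → ℤ, (∀ k, levelLap p q g k ≤ 0) → (∃ R, ∀ k, R ≤ |k| → min 0 k ≤ g k) →
    ∀ k, θ k ≤ g k

/-! ### Moving by steps of length `p` and `q` -/

theorem mem_of_steps {X : Set ℤ} {k r S : ℤ} (hX : ∀ j ∈ X, |j - k| ≤ S → j + r ∈ X)
    {a : ℤ} (ha : a ∈ X) (n : ℕ) (hn : |a - k| + n * |r| ≤ S) : a + n * r ∈ X := by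
  induction n with
  | zero => simpa using ha
  | succ n ih =>
    have hr := abs_nonneg r
    push_cast at hn
    have h1 : a + n * r ∈ X := ih (by nlinarith)
    have h2 : |a + n * r - k| ≤ |a - k| + n * |r| := by
      have : a + n * r - k = (a - k) + n * r := by ring
      rw [this]
      refine (abs_add_le _ _).trans ?_
      rw [abs_mul, Nat.abs_cast]
    have := hX _ h1 (by nlinarith)
    push_cast
    convert this using 1
    ring

theorem mem_of_int_steps {X : Set ℤ} {k r S : ℤ}
    (hX : ∀ j ∈ X, |j - k| ≤ S → j + r ∈ X ∧ j - r ∈ X)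
    {a : ℤ} (ha : a ∈ X) (n : ℤ) (hn : |a - k| + |n| * |r| ≤ S) : a + n * r ∈ X := by
  obtain ⟨m, rfl | rfl⟩ := n.eq_nat_or_neg
  · exact mem_of_steps (fun j hj h => (hX j hj h).1) ha m (by simpa using hn)
  · have := mem_of_steps (r := -r) (fun j hj h => by simpa [← sub_eq_add_neg] using (hX j hj h).2) ha m
      (by simpa using hn)
    convert this using 1
    ring

/-- Within a window whose size depends on `p` and `q` only, a set closed under the steps
`±p`, `±q` is closed under the steps `±1`. -/
theorem exists_window {p q : ℤ} (h : IsCoprime p q) :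
    ∃ S : ℤ, 0 ≤ S ∧ ∀ (X : Set ℤ) (k : ℤ), k ∈ X →
      (∀ j ∈ X, |j - k| ≤ S → j + p ∈ X ∧ j - p ∈ X ∧ j + q ∈ X ∧ j - q ∈ X) →
      k + 1 ∈ X ∧ k - 1 ∈ X := by
  obtain ⟨x, y, hxy⟩ := h
  have h1 := mul_nonneg (abs_nonneg x) (abs_nonneg p)
  have h2 := mul_nonneg (abs_nonneg y) (abs_nonneg q)
  -- As `x * p + y * q = 1`, a walk of `x` steps `p` and `y` steps `q` moves by one without leaving
  -- this radius.
  refine ⟨|x| * |p| + |y| * |q|, by positivity, fun X k hk hX => ?_⟩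
  have key : ∀ e : ℤ, |e| = 1 → k + e ∈ X := by
    intro e he
    have a1 : k + (e * x) * p ∈ X := by
      refine mem_of_int_steps (fun j hj hh => ⟨(hX j hj hh).1, (hX j hj hh).2.1⟩) hk _ ?_
      rw [abs_mul, he]; simp; positivity
    have a2 : k + (e * x) * p + (e * y) * q ∈ X := by
      refine mem_of_int_steps (fun j hj hh => (hX j hj hh).2.2) a1 _ ?_
      have : k + e * x * p - k = e * x * p := by ring
      rw [this, abs_mul, abs_mul, abs_mul e y, he]; simp
    convert a2 using 1
    linear_combination -e * hxy
  exact ⟨key 1 (by simp), by simpa [← sub_eq_add_neg] using key (-1) (by simp)⟩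

theorem mem_of_add_one {X : Set ℤ} {a : ℤ} (ha : a ∈ X)
    (h : ∀ k ∈ X, k + 1 ∈ X ∧ k - 1 ∈ X) (k : ℤ) : k ∈ X := by
  induction k using Int.inductionOn' (b := a) with
  | zero => exact ha
  | succ k _ ih => exact (h k ih).1
  | pred k _ ih => exact (h k ih).2

theorem mem_of_closed {p q : ℤ} (h : IsCoprime p q) {X : Set ℤ} {a : ℤ} (ha : a ∈ X)
    (hX : ∀ j ∈ X, j + p ∈ X ∧ j - p ∈ X ∧ j + q ∈ X ∧ j - q ∈ X) (k : ℤ) : k ∈ X := by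
  obtain ⟨S, -, hS⟩ := exists_window h
  exact mem_of_add_one ha (fun k hk => hS X k hk fun j hj _ => hX j hj) k

/-! ### Superharmonic functions of the level with slopes zero and one -/

/-- Superharmonic functions of the level with slopes zero and one that agree with `min 0 k` far
from the level zero. -/
structure IsStep (p q : ℤ) (g : ℤ → ℤ) : Prop where
  superharmonic : ∀ k, levelLap p q g k ≤ 0
  eventually_eq : ∃ R, ∀ k, R ≤ |k| → g k = min 0 k
  le_succ : ∀ k, g k ≤ g (k + 1)
  succ_le : ∀ k, g (k + 1) ≤ g k + 1

theorem levelLap_reflect (p q : ℤ) (g : ℤ → ℤ) (k : ℤ) :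
    levelLap p q (fun k => g (-k) + k) k = levelLap p q g (-k) := by
  have e1 : -(k + p) = -k - p := by ring
  have e2 : -(k - p) = -k + p := by ring
  have e3 : -(k + q) = -k - q := by ring
  have e4 : -(k - q) = -k + q := by ring
  simp only [levelLap, e1, e2, e3, e4]
  ring

theorem levelLap_shift (p q : ℤ) (g : ℤ → ℤ) (n c k : ℤ) :
    levelLap p q (fun k => g (k + n) + c) k = levelLap p q g (k + n) := by
  have e1 : k + p + n = k + n + p := by ring
  have e2 : k - p + n = k + n - p := by ring
  have e3 : k + q + n = k + n + q := by ring
  have e4 : k - q + n = k + n - q := by ring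
  simp only [levelLap, e1, e2, e3, e4]
  ring

theorem levelLap_min {p q : ℤ} {g h : ℤ → ℤ} {k : ℤ} (hg : levelLap p q g k ≤ 0)
    (hh : levelLap p q h k ≤ 0) : levelLap p q (fun k => min (g k) (h k)) k ≤ 0 := by
  simp only [levelLap] at *
  have := min_le_left (g (k + p)) (h (k + p))
  have := min_le_right (g (k + p)) (h (k + p))
  have := min_le_left (g (k - p)) (h (k - p))
  have := min_le_right (g (k - p)) (h (k - p))
  have := min_le_left (g (k + q)) (h (k + q))
  have := min_le_right (g (k + q)) (h (k + q))
  have := min_le_left (g (k - q)) (h (k - q))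
  have := min_le_right (g (k - q)) (h (k - q))
  rcases min_choice (g k) (h k) with e | e <;> rw [e] <;> omega

theorem levelLap_min_zero (p q k : ℤ) : levelLap p q (fun k => min 0 k) k ≤ 0 :=
  levelLap_min (g := fun _ => 0) (h := fun k => k) (by simp [levelLap])
    (by simp only [levelLap]; ring_nf; rfl)

namespace IsStep

variable {p q : ℤ} {g : ℤ → ℤ}

/-- The linear term is harmonic and turns slope `s` into `1 - s`, so statements about the left end
transfer to the right end. -/
theorem reflect (hg : IsStep p q g) : IsStep p q (fun k => g (-k) + k) where
  superharmonic k := by rw [levelLap_reflect]; exact hg.superharmonic _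
  eventually_eq := by
    obtain ⟨R, hR⟩ := hg.eventually_eq
    refine ⟨R, fun k hk => ?_⟩
    rw [hR (-k) (by rwa [abs_neg])]
    rcases le_total 0 k with h | h
    · rw [min_eq_right (by omega), min_eq_left h]; ring
    · rw [min_eq_left (by omega), min_eq_right h]; ring
  le_succ k := by
    have := hg.succ_le (-(k + 1))
    rw [show -(k + 1) + 1 = -k by ring] at this
    omega
  succ_le k := by
    have := hg.le_succ (-(k + 1))
    rw [show -(k + 1) + 1 = -k by ring] at this
    omega

theorem mono (hg : IsStep p q g) {a b : ℤ} (h : a ≤ b) : g a ≤ g b :=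
  monotone_int_of_le_succ hg.le_succ h

theorem sub_antitone (hg : IsStep p q g) {a b : ℤ} (h : a ≤ b) : g b - b ≤ g a - a :=
  antitone_int_of_succ_le (f := fun k => g k - k) (fun k => by have := hg.succ_le k; grind) h

theorem exists_eq_left (hg : IsStep p q g) : ∃ R, ∀ k ≤ R, g k = k := by
  obtain ⟨R, hR⟩ := hg.eventually_eq
  refine ⟨min 0 (-R), fun k hk => ?_⟩
  rw [hR k (by rw [abs_of_nonpos (by omega)]; omega), min_eq_right (by omega)]

theorem exists_eq_right (hg : IsStep p q g) : ∃ R, ∀ k, R ≤ k → g k = 0 := by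
  obtain ⟨R, hR⟩ := hg.eventually_eq
  refine ⟨max 0 R, fun k hk => ?_⟩
  rw [hR k (by rw [abs_of_nonneg (by omega)]; omega), min_eq_left (by omega)]

/-- A step function that has slope one on a long interval is the identity to the left of it. -/
theorem eq_of_slope_one (hg : IsStep p q g) (hpq : IsCoprime p q) {A B : ℤ}
    (hAB : A + 2 * (|p| + |q|) ≤ B) (h : ∀ k, A ≤ k → k ≤ B → g k - k = g B - B) :
    ∀ k ≤ B, g k = k := by
  obtain ⟨R, hR⟩ := hg.exists_eq_left
  set c := g B - B with hc
  -- Freeze `g k - k` at its minimum `c` to the right of `B`. The interval is so long that all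
  -- neighbours of a level lie either in `k ≤ B` or in `A ≤ k`, which keeps `w` superharmonic.
  let w : ℤ → ℤ := fun k => if k ≤ B then g k - k else c
  have hw1 : ∀ k ≤ B, w k = g k - k := fun k hk => if_pos hk
  have hw2 : ∀ k, A ≤ k → w k = c := by
    intro k hk
    by_cases hkB : k ≤ B
    · rw [hw1 k hkB, h k hk hkB]
    · exact if_neg hkB
  have hw3 : ∀ k, c ≤ w k := by
    intro k
    by_cases hkB : k ≤ B
    · rw [hw1 k hkB]; exact hg.sub_antitone hkB
    · exact (hw2 k (by have := abs_nonneg p; have := abs_nonneg q; omega)).ge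
  have hp := abs_le.1 (le_refl |p|)
  have hq := abs_le.1 (le_refl |q|)
  have hp0 := abs_nonneg p
  have hq0 := abs_nonneg q
  have hw : ∀ k, levelLap p q w k ≤ 0 := by
    intro k
    by_cases hk : k + (|p| + |q|) ≤ B
    · have := hg.superharmonic k
      simp only [levelLap] at this ⊢
      rw [hw1 _ (by omega), hw1 _ (by omega), hw1 _ (by omega), hw1 _ (by omega),
        hw1 _ (by omega)]
      omega
    · simp only [levelLap]
      rw [hw2 _ (by omega), hw2 _ (by omega), hw2 _ (by omega), hw2 _ (by omega),
        hw2 _ (by omega)]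
      omega
  -- Minimum principle: the set where `w` attains its minimum is closed under the steps.
  have hall : ∀ k, w k = c := by
    refine mem_of_closed hpq (X := {k | w k = c}) (a := B) (hw2 B (by omega)) fun j hj => ?_
    have h0 := hw j
    simp only [levelLap, Set.mem_ofPred_eq] at h0 hj ⊢
    have := hw3 (j + p)
    have := hw3 (j - p)
    have := hw3 (j + q)
    have := hw3 (j - q)
    omega
  have hc0 : c = 0 := by
    rw [← hall (min R B), hw1 _ (min_le_right _ _), hR _ (min_le_left _ _)]; ring
  intro k hk
  have := hall k
  rw [hw1 k hk] at this
  omega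

theorem eq_zero_of_slope_zero (hg : IsStep p q g) (hpq : IsCoprime p q) {A B : ℤ}
    (hAB : A + 2 * (|p| + |q|) ≤ B) (h : ∀ k, A ≤ k → k ≤ B → g k = g A) :
    ∀ k, A ≤ k → g k = 0 := by
  intro k hk
  have := hg.reflect.eq_of_slope_one hpq (A := -B) (B := -A) (by omega)
    (fun k h1 h2 => by
      have := h (-k) (by omega) (by omega)
      simp only [neg_neg]; omega) (-k) (by omega)
  simpa using this

theorem sub_le_of_le (hg : IsStep p q g) {a b : ℤ} (h : a ≤ b) : g b - g a ≤ b - a := by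
  have := hg.sub_antitone h
  omega

/-- Each summand is a difference of `E k = g (k + r) - g k` at distance `r`, so the sum telescopes
to `r` differences of values of `E`, which lie between `0` and `r`. The bound does not depend on
`n`. -/
theorem sum_second_difference_le (hg : IsStep p q g) (r : ℕ) (x : ℤ) (n : ℕ) :
    ∑ k ∈ Finset.range n, (2 * g (x + k) - g (x + k + r) - g (x + k - r)) ≤ (r : ℤ) * r := by
  let E : ℤ → ℤ := fun k => g (k + r) - g k
  have h0 : ∀ k, 0 ≤ E k := fun k => sub_nonneg.2 (hg.mono (by omega))
  have h1 : ∀ k, E k ≤ r := fun k => by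
    have := hg.sub_le_of_le (a := k) (b := k + r) (by omega)
    simp only [E]; omega
  have key : ∑ k ∈ Finset.range n, (2 * g (x + k) - g (x + k + r) - g (x + k - r))
      = ∑ i ∈ Finset.range r, (E (x - r + i) - E (x + n - r + i)) := by
    induction n with
    | zero => simp
    | succ n ih =>
      rw [Finset.sum_range_succ, ih]
      have tel := Finset.sum_range_sub' (fun i : ℕ => E (x + n - r + i)) r
      have e : ∑ i ∈ Finset.range r, (E (x - r + i) - E (x + (n + 1 : ℕ) - r + i))
          = ∑ i ∈ Finset.range r, (E (x - r + i) - E (x + n - r + i))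
            + ∑ i ∈ Finset.range r, (E (x + n - r + i) - E (x + n - r + (i + 1 : ℕ))) := by
        rw [← Finset.sum_add_distrib]
        refine Finset.sum_congr rfl fun i _ => ?_
        have : x + ((n + 1 : ℕ) : ℤ) - r + i = x + n - r + ((i + 1 : ℕ) : ℤ) := by
          push_cast; ring
        rw [this]; ring
      rw [e, tel]
      simp only [E]
      have e1 : x + n - r + ((0 : ℕ) : ℤ) + r = x + n := by push_cast; ring
      have e2 : x + n - r + ((0 : ℕ) : ℤ) = x + n - r := by push_cast; ring
      have e3 : x + n - r + (r : ℤ) = x + n := by ring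
      rw [e1, e2, e3]
      ring
  rw [key]
  refine (Finset.sum_le_card_nsmul _ _ (r : ℤ) fun i _ => ?_).trans (by simp)
  have := h0 (x + n - r + i)
  have := h1 (x - r + i)
  omega

theorem levelLap_natAbs (p q : ℤ) (g : ℤ → ℤ) (k : ℤ) :
    levelLap p.natAbs q.natAbs g k = levelLap p q g k := by
  rcases Int.natAbs_eq p with hp | hp <;> rcases Int.natAbs_eq q with hq | hq <;>
    simp only [levelLap] <;> generalize p.natAbs = a at * <;> generalize q.natAbs = b at * <;>
    subst hp hq <;> simp only [sub_neg_eq_add, ← sub_eq_add_neg] <;> ring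

/-- The total mass of the Laplacian of a step function is bounded. -/
theorem sum_neg_levelLap_le (hg : IsStep p q g) (x : ℤ) (n : ℕ) :
    ∑ k ∈ Finset.range n, -levelLap p q g (x + k) ≤ p * p + q * q := by
  have h1 := hg.sum_second_difference_le p.natAbs x n
  have h2 := hg.sum_second_difference_le q.natAbs x n
  rw [← Int.natAbs_mul_self' p, ← Int.natAbs_mul_self' q]
  refine le_trans (le_of_eq ?_) (add_le_add h1 h2)
  rw [← Finset.sum_add_distrib]
  refine Finset.sum_congr rfl fun k _ => ?_
  rw [← levelLap_natAbs, levelLap]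
  ring

/-- In a window without mass the slope is constant away from the ends. -/
theorem slope_const (hg : IsStep p q g) {S : ℤ}
    (hS : ∀ (X : Set ℤ) (k : ℤ), k ∈ X →
      (∀ j ∈ X, |j - k| ≤ S → j + p ∈ X ∧ j - p ∈ X ∧ j + q ∈ X ∧ j - q ∈ X) →
      k + 1 ∈ X ∧ k - 1 ∈ X)
    {A B : ℤ} (h : ∀ k, A ≤ k → k ≤ B + 1 → levelLap p q g k = 0) :
    (∀ k, A + S ≤ k → k ≤ B - S → g (k + 1) = g k + 1) ∨
      (∀ k, A + S ≤ k → k ≤ B - S → g (k + 1) = g k) := by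
  by_cases hex : ∃ a, A + S ≤ a ∧ a ≤ B - S ∧ g (a + 1) = g a + 1
  · left
    obtain ⟨a, ha1, ha2, ha⟩ := hex
    have step : ∀ k, A + S ≤ k → k ≤ B - S → g (k + 1) = g k + 1 →
        g (k + 1 + 1) = g (k + 1) + 1 ∧ g (k - 1 + 1) = g (k - 1) + 1 := by
      intro k h1 h2 hk
      -- Subtracting harmonicity at `j` from that at `j + 1`: the four slopes at the neighbours add
      -- up to four, and each is at most one.
      refine hS {j | g (j + 1) = g j + 1} k hk fun j hj hjk => ?_
      have hj' := abs_le.1 hjk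
      have e1 := h j (by omega) (by omega)
      have e2 := h (j + 1) (by omega) (by omega)
      have i1 := hg.succ_le (j + p)
      have i2 := hg.succ_le (j - p)
      have i3 := hg.succ_le (j + q)
      have i4 := hg.succ_le (j - q)
      simp only [levelLap, Set.mem_ofPred_eq] at *
      rw [show j + 1 + p = j + p + 1 by ring, show j + 1 - p = j - p + 1 by ring,
        show j + 1 + q = j + q + 1 by ring, show j + 1 - q = j - q + 1 by ring] at e2
      omega
    have up : ∀ n : ℕ, a + n ≤ B - S → g (a + n + 1) = g (a + n) + 1 := by
      intro n
      induction n with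
      | zero => intro _; simpa using ha
      | succ n ih =>
        intro hn
        push_cast at hn ⊢
        rw [← add_assoc a]
        exact (step _ (by omega) (by omega) (ih (by omega))).1
    have down : ∀ n : ℕ, A + S ≤ a - n → g (a - n + 1) = g (a - n) + 1 := by
      intro n
      induction n with
      | zero => intro _; simpa using ha
      | succ n ih =>
        intro hn
        push_cast at hn ⊢
        rw [← sub_sub a]
        exact (step _ (by omega) (by omega) (ih (by omega))).2
    intro k h1 h2
    rcases le_total a k with hak | hak
    · have := up (k - a).toNat (by omega)
      rwa [Int.toNat_of_nonneg (by omega), show a + (k - a) = k by ring] at this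
    · have := down (a - k).toNat (by omega)
      rwa [Int.toNat_of_nonneg (by omega), show a - (a - k) = k by ring] at this
  · right
    push Not at hex
    intro k h1 h2
    have := hex k h1 h2
    have := hg.le_succ k
    have := hg.succ_le k
    omega

theorem eq_add_of_slope {A B c : ℤ} (h : ∀ k, A ≤ k → k < B → g (k + 1) = g k + c) :
    ∀ k, A ≤ k → k ≤ B → g k = g A + c * (k - A) := by
  intro k hk
  induction k, hk using Int.leInduction with
  | base => intro _; ring
  | succ k hk ih =>
    intro hkB
    rw [h k hk (by omega), ih (by omega)]
    ring

/-- Pigeonhole: a block that is not free carries mass at least one, and there are more blocks than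
mass. -/
theorem exists_free_window {μ : ℤ → ℤ} (h0 : ∀ k, 0 ≤ μ k) {m : ℤ} {N W : ℕ} {x : ℤ}
    (hm : ∑ k ∈ Finset.range (N * W), μ (x + k) ≤ m) (hN : m < N) :
    ∃ i < N, ∀ j : ℕ, j < W → μ (x + (i * W : ℕ) + j) = 0 := by
  by_contra hcon
  push Not at hcon
  have : ∀ n ≤ N, (n : ℤ) ≤ ∑ k ∈ Finset.range (n * W), μ (x + k) := by
    intro n
    induction n with
    | zero => simp
    | succ n ih =>
      intro hn
      obtain ⟨j, hj, hne⟩ := hcon n (by omega)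
      rw [Nat.succ_mul, Finset.sum_range_add]
      have h1 : 1 ≤ ∑ i ∈ Finset.range W, μ (x + ((n * W + i : ℕ) : ℤ)) := by
        refine le_trans ?_ (Finset.single_le_sum (f := fun i : ℕ => μ (x + ((n * W + i : ℕ) : ℤ)))
          (fun i _ => h0 _) (Finset.mem_range.2 hj))
        have := h0 (x + (n * W : ℕ) + j)
        have e : x + ((n * W + j : ℕ) : ℤ) = x + (n * W : ℕ) + j := by push_cast; ring
        simp only [e]
        omega
      have := ih (by omega)
      push_cast at *
      linarith
  have := this N le_rfl
  omega

end IsStep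

/-- The support of `g - min 0 k` is bounded uniformly over all step functions `g`. -/
theorem exists_support_bound {p q : ℤ} (hpq : IsCoprime p q) :
    ∃ N : ℤ, 0 ≤ N ∧ ∀ g, IsStep p q g → (∀ k ≤ -N, g k = k) ∧ ∀ k, N ≤ k → g k = 0 := by
  obtain ⟨S, hS0, hS⟩ := exists_window hpq
  have hp0 := abs_nonneg p
  have hq0 := abs_nonneg q
  -- `slope_const` loses `S` at each end of a window; what remains is long enough for
  -- `eq_of_slope_one` and `eq_zero_of_slope_zero`.
  obtain ⟨W, hW⟩ : ∃ W : ℕ, (W : ℤ) = 2 * S + 2 * (|p| + |q|) + 2 :=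
    ⟨(2 * S + 2 * (|p| + |q|) + 2).toNat, Int.toNat_of_nonneg (by omega)⟩
  obtain ⟨m, hm⟩ : ∃ m : ℕ, (m : ℤ) = p * p + q * q + 1 :=
    ⟨(p * p + q * q + 1).toNat, Int.toNat_of_nonneg (by nlinarith)⟩
  refine ⟨(m * W : ℕ) + 1, by positivity, fun g hg => ?_⟩
  obtain ⟨R₁, hR₁⟩ := hg.exists_eq_left
  obtain ⟨R₂, hR₂⟩ := hg.exists_eq_right
  -- the last level where `g` is the identity
  obtain ⟨a, ha, ha'⟩ := Int.exists_greatest_of_bdd (P := fun k => g k = k)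
    ⟨max R₂ 0, fun z hz => by
      by_contra! hcon
      have := hR₂ z (by omega)
      omega⟩ ⟨R₁, hR₁ _ le_rfl⟩
  have hal : ∀ k ≤ a, g k = k := by
    intro k hk
    have h1 := hg.sub_antitone hk
    have h2 := hg.sub_antitone (min_le_left k R₁)
    rw [hR₁ _ (min_le_right _ _)] at h2
    omega
  obtain ⟨b, hb, hb'⟩ := Int.exists_least_of_bdd (P := fun k => g k = 0)
    ⟨min R₁ 0, fun z hz => by
      by_contra! hcon
      have := hR₁ z (by omega)
      omega⟩ ⟨R₂, hR₂ _ le_rfl⟩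
  have hbr : ∀ k, b ≤ k → g k = 0 := by
    intro k hk
    have h1 := hg.mono hk
    have h2 := hg.mono (le_max_left k R₂)
    rw [hR₂ _ (le_max_right _ _)] at h2
    omega
  -- Otherwise there is a window without mass between `a` and `b`. Slope one there contradicts the
  -- maximality of `a`, slope zero the minimality of `b`.
  have hab : b - a ≤ (m * W : ℕ) + 1 := by
    by_contra! hcon
    obtain ⟨i, hi, hfree⟩ := IsStep.exists_free_window (μ := fun k => -levelLap p q g k)
      (fun k => by have := hg.superharmonic k; omega) (N := m) (W := W) (x := a + 1)
      (hg.sum_neg_levelLap_le _ _) (by omega)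
    have hiW : i * W + W ≤ m * W := by
      rw [← Nat.succ_mul]; exact Nat.mul_le_mul_right _ hi
    generalize i * W = t at *
    generalize m * W = M at *
    have hlap : ∀ k, a + 1 + t ≤ k → k ≤ a + 1 + t + (W - 2) + 1 → levelLap p q g k = 0 := by
      intro k h1 h2
      have := hfree (k - (a + 1 + t)).toNat (by omega)
      rw [Int.toNat_of_nonneg (by omega), show a + 1 + (t : ℤ) + (k - (a + 1 + t)) = k by ring]
        at this
      omega
    rcases hg.slope_const hS hlap with h | h
    · have e := IsStep.eq_add_of_slope (A := a + 1 + t + S) (B := a + 1 + t + (W - 2) - S + 1)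
        (c := 1) (g := g) (fun k h1 h2 => h k h1 (by omega))
      have e' := e (a + 1 + t + (W - 2) - S + 1) (by omega) le_rfl
      have := hg.eq_of_slope_one hpq (A := a + 1 + t + S) (B := a + 1 + t + (W - 2) - S + 1)
        (by omega) (fun k h1 h2 => by rw [e k h1 h2, e']; ring) _ le_rfl
      have := ha' _ this
      omega
    · have e := IsStep.eq_add_of_slope (A := a + 1 + t + S) (B := a + 1 + t + (W - 2) - S + 1)
        (c := 0) (g := g) (fun k h1 h2 => by rw [h k h1 (by omega)]; ring)
      have := hg.eq_zero_of_slope_zero hpq (A := a + 1 + t + S)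
        (B := a + 1 + t + (W - 2) - S + 1)
        (by omega) (fun k h1 h2 => by rw [e k h1 h2]; ring) _ le_rfl
      have := hb' _ this
      omega
  have hab' : a ≤ b := by
    by_contra! hcon
    have e1 := ha' (a + 1)
    have h1 := hbr a hcon.le
    have h2 := hal b hcon.le
    omega
  have h1 := hg.mono hab'
  have h2 := hg.sub_le_of_le hab'
  -- The slope bounds with `g a = a` and `g b = 0` give `a ≤ 0 ≤ b`, so the bound on `b - a` bounds
  -- both.
  exact ⟨fun k hk => hal k (by omega), fun k hk => hbr k (by omega)⟩

/-! ### Existence of the profile -/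

/-- Obstacles with slopes zero and one below `min 0 k`. -/
def obstacle (n k : ℤ) : ℤ := max (min k (-n)) (min (k - n) 0)

/-- The least superharmonic majorant of an obstacle exists. -/
theorem exists_least_majorant (p q n : ℤ) (hn : 0 ≤ n) :
    ∃ g : ℤ → ℤ, (∀ k, levelLap p q g k ≤ 0) ∧ (∀ k, obstacle n k ≤ g k) ∧
      ∀ h : ℤ → ℤ, (∀ k, levelLap p q h k ≤ 0) → (∀ k, obstacle n k ≤ h k) → ∀ k, g k ≤ h k := by
  have : ∀ k, ∃ z, (∃ h : ℤ → ℤ, (∀ k, levelLap p q h k ≤ 0) ∧ (∀ k, obstacle n k ≤ h k) ∧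
      h k = z) ∧ ∀ h : ℤ → ℤ, (∀ k, levelLap p q h k ≤ 0) → (∀ k, obstacle n k ≤ h k) →
        z ≤ h k := by
    intro k
    obtain ⟨z, hz, hz'⟩ := Int.exists_least_of_bdd
      (P := fun z => ∃ h : ℤ → ℤ, (∀ k, levelLap p q h k ≤ 0) ∧ (∀ k, obstacle n k ≤ h k) ∧
        h k = z) ⟨obstacle n k, by rintro z ⟨h, -, h2, rfl⟩; exact h2 k⟩
      ⟨_, fun k => min 0 k, levelLap_min_zero p q,
        fun k => by simp only [obstacle]; omega, rfl⟩
    exact ⟨z, hz, fun h h1 h2 => hz' _ ⟨h, h1, h2, rfl⟩⟩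
  choose g hg hg' using this
  refine ⟨g, fun k => ?_, fun k => ?_, fun h h1 h2 k => hg' k h h1 h2⟩
  -- The infimum is attained at `k` by some competitor `h`, and at the neighbours it is at most `h`.
  · obtain ⟨h, h1, h2, h3⟩ := hg k
    have := h1 k
    simp only [levelLap] at *
    have := hg' (k + p) h h1 h2
    have := hg' (k - p) h h1 h2
    have := hg' (k + q) h h1 h2
    have := hg' (k - q) h h1 h2
    omega
  · obtain ⟨h, h1, h2, h3⟩ := hg k
    rw [← h3]
    exact h2 k

/-- The least majorant of every obstacle is a step function, by comparison with its own translates.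
By the uniform support bound `N`, all of them lie above the obstacle of size `2 * N`, so the least
majorant of that one is below all the others. Any competitor for the profile lies above some deeper
obstacle. -/
theorem exists_isProfile {p q : ℤ} (hpq : IsCoprime p q) : ∃ θ, IsProfile p q θ := by
  have maj : ∀ n : ℤ, 0 ≤ n → ∃ g : ℤ → ℤ, IsStep p q g ∧ (∀ k, obstacle n k ≤ g k) ∧
      ∀ h : ℤ → ℤ, (∀ k, levelLap p q h k ≤ 0) → (∀ k, obstacle n k ≤ h k) →
        ∀ k, g k ≤ h k := by
    intro n hn
    obtain ⟨g, h1, h2, h3⟩ := exists_least_majorant p q n hn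
    refine ⟨g, ⟨h1, ⟨n, fun k hk => ?_⟩, fun k => ?_, fun k => ?_⟩, h2, h3⟩
    · refine le_antisymm (h3 _ (levelLap_min_zero p q) (fun k => by
        simp only [obstacle]; omega) k) (le_trans ?_ (h2 k))
      simp only [obstacle]
      rcases le_abs.1 hk with h | h <;> omega
    · refine h3 (fun k => g (k + 1) + 0) (fun k => by rw [levelLap_shift]; exact h1 _)
        (fun k => ?_) k |>.trans (by simp)
      have := h2 (k + 1)
      simp only [obstacle] at this ⊢
      omega
    · have := h3 (fun k => g (k + -1) + 1) (fun k => by rw [levelLap_shift]; exact h1 _)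
        (fun k => by
          have := h2 (k + -1)
          simp only [obstacle] at this ⊢
          omega) (k + 1)
      simpa using this
  obtain ⟨N, hN0, hN⟩ := exists_support_bound hpq
  obtain ⟨θ, hθ, -, hθ'⟩ := maj (2 * N) (by omega)
  refine ⟨θ, hθ.superharmonic, hθ.eventually_eq, fun h h1 ⟨R, h2⟩ => ?_⟩
  obtain ⟨c, hc⟩ : ∃ c, ∀ k, -|R| ≤ k → k ≤ |R| → c ≤ h k := by
    obtain ⟨c, hc⟩ := ((Set.finite_Icc (-|R|) |R|).image h).bddBelow
    exact ⟨c, fun k h1 h2 => hc ⟨k, ⟨h1, h2⟩, rfl⟩⟩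
  -- An obstacle of this size is at most `c` on the levels between `-|R|` and `|R|`, where only `c ≤
  -- h` is known.
  obtain ⟨g, hg, -, hg'⟩ := maj (max (2 * N) (|R| - min c 0)) (by omega)
  have hgh : ∀ k, g k ≤ h k := by
    refine hg' h h1 fun k => ?_
    by_cases hk : R ≤ |k|
    · refine le_trans ?_ (h2 k hk)
      simp only [obstacle]
      omega
    · have hR := le_abs_self R
      have := abs_lt.1 (not_le.1 hk)
      have := hc k (by omega) (by omega)
      simp only [obstacle]
      omega
  refine fun k => (hθ' g hg.superharmonic (fun k => ?_) k).trans (hgh k)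
  obtain ⟨e1, e2⟩ := hN g hg
  simp only [obstacle]
  rcases le_total k (-N) with h | h
  · rw [e1 k h]; omega
  · rcases le_total N k with h' | h'
    · rw [e2 k h']; omega
    · have := hg.mono h
      rw [e1 _ le_rfl] at this
      omega

/-! ### Paths of levels and first consequences of minimality -/

/-- Levels of adjacent vertices. -/
def LevelStep (p q j k : ℤ) : Prop := k = j + p ∨ k = j - p ∨ k = j + q ∨ k = j - q

/-- Paths of levels whose vertices, except perhaps for the first one, lie in `X`. -/
def LevelPath (p q : ℤ) (X : Set ℤ) : ℤ → ℤ → Prop :=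
  Relation.ReflTransGen fun j k => LevelStep p q j k ∧ k ∈ X

theorem LevelStep.neg {p q j k : ℤ} (h : LevelStep p q j k) : LevelStep p q (-j) (-k) := by
  simp only [LevelStep] at *; omega

theorem LevelStep.add_right {p q j k : ℤ} (h : LevelStep p q j k) (n : ℤ) :
    LevelStep p q (j + n) (k + n) := by
  simp only [LevelStep] at *; omega

theorem LevelPath.mem {p q : ℤ} {X : Set ℤ} {j k : ℤ} (h : LevelPath p q X j k) (hj : j ∈ X) :
    k ∈ X := by
  rcases Relation.ReflTransGen.cases_tail h with rfl | ⟨_, _, h⟩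
  · exact hj
  · exact h.2

theorem LevelPath.shift {p q : ℤ} {B : Set ℤ} {s t : ℤ} (n : ℤ) (h : LevelPath p q B s t) :
    LevelPath p q {b | b + n ∈ B} (s - n) (t - n) := by
  induction h with
  | refl => exact Relation.ReflTransGen.refl
  | tail _ h ih =>
    refine Relation.ReflTransGen.tail ih ⟨?_, ?_⟩
    · simpa [← sub_eq_add_neg] using h.1.add_right (-n)
    · simpa using h.2

namespace IsProfile

variable {p q : ℤ} {θ : ℤ → ℤ}

theorem le_min (hθ : IsProfile p q θ) (k : ℤ) : θ k ≤ min 0 k :=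
  hθ.le _ (levelLap_min_zero p q) ⟨0, fun _ _ => le_rfl⟩ k

theorem le_zero (hθ : IsProfile p q θ) (k : ℤ) : θ k ≤ 0 := (hθ.le_min k).trans (min_le_left _ _)

theorem le_self (hθ : IsProfile p q θ) (k : ℤ) : θ k ≤ k := (hθ.le_min k).trans (min_le_right _ _)

theorem exists_eq (hθ : IsProfile p q θ) :
    ∃ R, 0 ≤ R ∧ (∀ k ≤ -R, θ k = k) ∧ ∀ k, R ≤ k → θ k = 0 := by
  obtain ⟨R, hR⟩ := hθ.eventually_eq
  refine ⟨max R 0, by omega, fun k hk => ?_, fun k hk => ?_⟩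
  · rw [hR k (le_abs.2 (by omega))]; omega
  · rw [hR k (le_abs.2 (by omega))]; omega

theorem neg (hθ : IsProfile p q θ) : IsProfile (-p) (-q) θ := by
  have e : ∀ g k, levelLap (-p) (-q) g k = levelLap p q g k := by
    intro g k
    simp only [levelLap, sub_neg_eq_add, ← sub_eq_add_neg]
    ring
  exact ⟨fun k => by rw [e]; exact hθ.superharmonic k, hθ.eventually_eq,
    fun g hg => hθ.le g fun k => by rw [← e]; exact hg k⟩

/-- Minimality, translated: `θ (k - n) + n` is the least function for the data `min n k`. Waves use
it with `n = 1`. -/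
theorem le_shift (hθ : IsProfile p q θ) {g : ℤ → ℤ} (hg : ∀ k, levelLap p q g k ≤ 0) (n : ℤ)
    (h : ∃ R, ∀ k, R ≤ |k| → min n k ≤ g k) (k : ℤ) : θ (k - n) + n ≤ g k := by
  have := hθ.le (fun k => g (k + n) + -n) (fun k => by rw [levelLap_shift]; exact hg _) (by
    obtain ⟨R, hR⟩ := h
    refine ⟨R + |n|, fun k hk => ?_⟩
    have := hR (k + n) (by
      have := abs_sub_abs_le_abs_add k n
      omega)
    omega) (k - n)
  simp only [sub_add_cancel] at this
  omega

/-- Both slope bounds come from minimality against the translates `θ (k + 1)` and `θ (k - 1) + 1`.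
-/
theorem toIsStep (hθ : IsProfile p q θ) : IsStep p q θ := by
  obtain ⟨R, hR0, h1, h2⟩ := hθ.exists_eq
  have hmin : ∀ k, R ≤ |k| → θ k = min 0 k := by
    intro k hk
    rcases le_abs.1 hk with h | h
    · rw [h2 k h]; omega
    · rw [h1 k (by omega)]; omega
  refine ⟨hθ.superharmonic, hθ.eventually_eq, fun k => ?_, fun k => ?_⟩
  · have h := hθ.le (fun k => θ (k + 1) + 0) (fun k => by
      rw [levelLap_shift]; exact hθ.superharmonic _) ⟨R + 1, fun k hk => by
        rw [hmin (k + 1) (by rcases le_abs.1 hk with h | h <;> apply le_abs.2 <;> omega)]; omega⟩ k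
    simpa using h
  · have h := hθ.le (fun k => θ (k + -1) + 1) (fun k => by
      rw [levelLap_shift]; exact hθ.superharmonic _) ⟨R + 1, fun k hk => by
        rw [hmin (k + -1) (by rcases le_abs.1 hk with h | h <;> apply le_abs.2 <;> omega)]
        omega⟩ (k + 1)
    simpa using h

/-- The reflected function competes with `θ`; applying the resulting inequality at `k` and at `-k`
gives equality. This is the source of the central symmetry of the state. -/
theorem reflect (hθ : IsProfile p q θ) (k : ℤ) : θ (-k) = θ k - k := by
  have h : ∀ k, θ k ≤ θ (-k) + k := by
    refine hθ.le _ hθ.toIsStep.reflect.superharmonic ?_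
    obtain ⟨R, hR⟩ := hθ.toIsStep.reflect.eventually_eq
    exact ⟨R, fun k hk => (hR k hk).ge⟩
  have h1 := h k
  have h2 := h (-k)
  rw [neg_neg] at h2
  omega

theorem levelLap_neg (hθ : IsProfile p q θ) (k : ℤ) :
    levelLap p q θ (-k) = levelLap p q θ k := by
  rw [← levelLap_reflect p q θ k]
  congr 1
  funext j
  rw [hθ.reflect]; ring

/-- Were the Laplacian at most `-4` at `k`, `θ` could be lowered by one there and stay
superharmonic. -/
theorem neg_three_le (hθ : IsProfile p q θ) (k : ℤ) : -3 ≤ levelLap p q θ k := by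
  by_contra! hcon
  have h := hθ.le (fun j => if j = k then θ j - 1 else θ j) (fun j => by
    have h0 := hθ.superharmonic j
    have hle : ∀ i, (if i = k then θ i - 1 else θ i) ≤ θ i := fun i => by split_ifs <;> omega
    simp only [levelLap] at *
    have := hle (j + p)
    have := hle (j - p)
    have := hle (j + q)
    have := hle (j - q)
    by_cases hj : j = k
    · subst hj
      rw [if_pos (rfl : j = j)]
      omega
    · rw [if_neg hj]
      omega) (by
    obtain ⟨R, hR⟩ := hθ.eventually_eq
    refine ⟨max R (|k| + 1), fun j hj => ?_⟩
    rw [if_neg (by rintro rfl; omega), hR j (by omega)]) k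
  rw [if_pos rfl] at h
  omega

theorem shift_superharmonic (hθ : IsProfile p q θ) (n k : ℤ) :
    levelLap p q (fun k => θ (k - n) + n) k ≤ 0 := by
  have := levelLap_shift p q θ (-n) n k
  simp only [← sub_eq_add_neg] at this
  rw [this]
  exact hθ.superharmonic _

/-- Levels of slope one are connected with the levels near `-∞`. -/
theorem exists_path_of_slope_one (hθ : IsProfile p q θ) {k : ℤ} (hk : θ k = θ (k - 1) + 1)
    (r : ℤ) : ∃ j < r, LevelPath p q {j | θ j = θ (j - 1) + 1} k j := by
  classical
  by_contra! hcon
  set C : Set ℤ := {j | LevelPath p q {j | θ j = θ (j - 1) + 1} k j} with hC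
  have hCZ : ∀ j ∈ C, θ j = θ (j - 1) + 1 := fun j hj =>
    LevelPath.mem (X := {j | θ j = θ (j - 1) + 1}) hj hk
  have hCr : ∀ j ∈ C, r ≤ j := fun j hj => not_lt.1 fun h => hcon j h hj
  obtain ⟨R, hR0, hR1, hR2⟩ := hθ.exists_eq
  have hCR : ∀ j ∈ C, j ≤ R := by
    intro j hj
    by_contra! h
    have := hCZ j hj
    rw [hR2 j h.le, hR2 (j - 1) (by omega)] at this
    omega
  -- If the component `C` were bounded below, lowering `θ` by one on it would contradict minimality:
  -- on `C` and its neighbours `g` is `θ` moved by one level, so its Laplacian on `C` is that of `θ`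
  -- one level down.
  let g : ℤ → ℤ := fun j => if j ∈ C then θ j - 1 else θ j
  have hgC : ∀ j ∈ C, g j = θ j - 1 := fun j hj => if_pos hj
  have hgn : ∀ j, j ∉ C → g j = θ j := fun j hj => if_neg hj
  have hgle : ∀ j, g j ≤ θ j := fun j => by simp only [g]; split_ifs <;> omega
  have hnb : ∀ j ∈ C, ∀ i, LevelStep p q j i → g i = θ (i - 1) := by
    intro j hj i hi
    by_cases hiC : i ∈ C
    · rw [hgC i hiC, hCZ i hiC]; ring
    · have : ¬ θ i = θ (i - 1) + 1 := fun h => hiC (Relation.ReflTransGen.tail hj ⟨hi, h⟩)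
      have a1 := hθ.toIsStep.le_succ (i - 1)
      have a2 := hθ.toIsStep.succ_le (i - 1)
      rw [sub_add_cancel] at a1 a2
      rw [hgn i hiC]; omega
  have h := hθ.le g (fun j => by
    by_cases hj : j ∈ C
    · have h0 := hθ.superharmonic (j - 1)
      simp only [levelLap] at h0 ⊢
      rw [hnb j hj _ (Or.inl rfl), hnb j hj _ (Or.inr (Or.inl rfl)),
        hnb j hj _ (Or.inr (Or.inr (Or.inl rfl))), hnb j hj _ (Or.inr (Or.inr (Or.inr rfl))),
        hgC j hj, hCZ j hj, show j + p - 1 = j - 1 + p by ring, show j - p - 1 = j - 1 - p by ring,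
        show j + q - 1 = j - 1 + q by ring, show j - q - 1 = j - 1 - q by ring]
      omega
    · have h0 := hθ.superharmonic j
      simp only [levelLap] at h0 ⊢
      have := hgle (j + p)
      have := hgle (j - p)
      have := hgle (j + q)
      have := hgle (j - q)
      rw [hgn j hj]
      omega) (by
    obtain ⟨R', hR'⟩ := hθ.eventually_eq
    refine ⟨max R' (max R (-r) + 1), fun j hj => ?_⟩
    rw [hgn j, hR' j (by omega)]
    intro hjC
    have := hCr j hjC
    have := hCR j hjC
    have := abs_le.2 (show -(max R (-r)) ≤ j ∧ j ≤ max R (-r) by omega)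
    omega) k
  rw [hgC k Relation.ReflTransGen.refl] at h
  omega

/-- Levels where the profile differs from the identity are connected with the levels near `+∞`. -/
theorem exists_path_of_lt_self (hθ : IsProfile p q θ) {k : ℤ} (hk : θ k < k) (r : ℤ) :
    ∃ j, r < j ∧ LevelPath p q {j | θ j < j} k j := by
  classical
  by_contra! hcon
  set C : Set ℤ := {j | LevelPath p q {j | θ j < j} k j} with hC
  have hCD : ∀ j ∈ C, θ j < j := fun j hj => LevelPath.mem (X := {j | θ j < j}) hj hk
  have hCr : ∀ j ∈ C, j ≤ r := fun j hj => not_lt.1 fun h => hcon j h hj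
  obtain ⟨R, hR0, hR1, hR2⟩ := hθ.exists_eq
  obtain ⟨n, hn0, hn⟩ : ∃ n, 0 ≤ n ∧ k - n ≤ -R := ⟨max 0 (k + R), by omega, by omega⟩
  have hθn : ∀ j, θ j ≤ θ (j - n) + n := fun j => by
    have := hθ.toIsStep.sub_le_of_le (a := j - n) (b := j) (by omega)
    omega
  have hid : ∀ j, θ (j - n) + n ≤ j := fun j => by
    have := hθ.le_self (j - n)
    omega
  -- Outside a bounded `C`, replace `θ` by a translate that is still the identity at `k`. Both
  -- functions equal the identity at neighbours of `C` outside it, so the glued function is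
  -- superharmonic and would force `k ≤ θ k`.
  let g : ℤ → ℤ := fun j => if j ∈ C then θ j else θ (j - n) + n
  have hgC : ∀ j ∈ C, g j = θ j := fun j hj => if_pos hj
  have hgn : ∀ j, j ∉ C → g j = θ (j - n) + n := fun j hj => if_neg hj
  have hgle : ∀ j, g j ≤ θ (j - n) + n := fun j => by
    by_cases hj : j ∈ C
    · rw [hgC j hj]; exact hθn j
    · exact (hgn j hj).le
  have hnb : ∀ j ∈ C, ∀ i, LevelStep p q j i → g i = θ i := by
    intro j hj i hi
    by_cases hiC : i ∈ C
    · exact hgC i hiC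
    · have : ¬ θ i < i := fun h => hiC (Relation.ReflTransGen.tail hj ⟨hi, h⟩)
      have := hid i
      have := hθn i
      rw [hgn i hiC]; omega
  have h := hθ.le_shift (g := g) (fun j => by
    by_cases hj : j ∈ C
    · have h0 := hθ.superharmonic j
      simp only [levelLap] at h0 ⊢
      rwa [hnb j hj _ (Or.inl rfl), hnb j hj _ (Or.inr (Or.inl rfl)),
        hnb j hj _ (Or.inr (Or.inr (Or.inl rfl))), hnb j hj _ (Or.inr (Or.inr (Or.inr rfl))),
        hgC j hj]
    · have h0 := hθ.shift_superharmonic n j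
      simp only [levelLap] at h0 ⊢
      have := hgle (j + p)
      have := hgle (j - p)
      have := hgle (j + q)
      have := hgle (j - q)
      rw [hgn j hj]
      omega) n ⟨max (R + n) (r + 1), fun j hj => by
    rcases le_total j 0 with hj0 | hj0
    · rw [abs_of_nonpos hj0] at hj
      have e1 := hR1 j (by omega)
      have := hθn j
      by_cases hjC : j ∈ C
      · have := hCD j hjC; omega
      · rw [hgn j hjC]; omega
    · rw [abs_of_nonneg hj0] at hj
      rw [hgn j fun hjC => by have := hCr j hjC; omega, hR2 _ (by omega)]
      omega⟩ k
  rw [hgC k Relation.ReflTransGen.refl, hR1 _ hn] at h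
  omega

end IsProfile

/-! ### Barriers of levels -/

/-- A bounded set of levels that separates the levels near `-∞` from those near `+∞`: there is a
potential which is constant along paths that avoid `B` and takes different values at the ends. -/
def IsBarrier (p q : ℤ) (B : Set ℤ) : Prop :=
  ∃ (ν : ℤ → ℤ) (c₁ c₂ R : ℤ), c₁ ≠ c₂ ∧
    (∀ s t, LevelStep p q s t → s ∉ B → t ∉ B → ν s = ν t) ∧
    (∀ s, R < s → ν s = c₁) ∧ (∀ s, s < -R → ν s = c₂) ∧ ∀ b ∈ B, -R ≤ b ∧ b ≤ R

theorem exists_pos_step {p q : ℤ} (hpq : IsCoprime p q) :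
    ∃ r, 0 < r ∧ (∀ s, LevelStep p q s (s + r)) ∧ (∀ s, LevelStep p q s (s - r)) ∧
      ∀ s t, LevelStep p q s t → s - r ≤ t ∧ t ≤ s + r := by
  have h0 : p ≠ 0 ∨ q ≠ 0 := by
    by_contra! h
    obtain ⟨x, y, hxy⟩ := hpq
    simp [h.1, h.2] at hxy
  refine ⟨max |p| |q|, ?_, ?_, ?_, ?_⟩
  · rcases h0 with h | h
    · exact lt_max_of_lt_left (abs_pos.2 h)
    · exact lt_max_of_lt_right (abs_pos.2 h)
  all_goals
    simp only [LevelStep]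
    rcases abs_cases p with h | h <;> rcases abs_cases q with h' | h' <;> omega

namespace IsBarrier

variable {p q : ℤ} {B : Set ℤ}

theorem neg (hB : IsBarrier p q B) : IsBarrier p q {b | -b ∈ B} := by
  obtain ⟨ν, c₁, c₂, R, hne, h1, h2, h3, h4⟩ := hB
  exact ⟨fun s => ν (-s), c₂, c₁, R, hne.symm, fun s t hst hs ht => h1 _ _ hst.neg hs ht,
    fun s hs => h3 _ (by omega), fun s hs => h2 _ (by omega), fun b hb => by
      have := h4 _ hb
      omega⟩

theorem shift (hB : IsBarrier p q B) (n : ℤ) : IsBarrier p q {b | b + n ∈ B} := by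
  obtain ⟨ν, c₁, c₂, R, hne, h1, h2, h3, h4⟩ := hB
  have := neg_abs_le n
  have := le_abs_self n
  exact ⟨fun s => ν (s + n), c₁, c₂, R + |n|, hne,
    fun s t hst hs ht => h1 _ _ (hst.add_right n) hs ht,
    fun s hs => h2 _ (by omega), fun s hs => h3 _ (by omega), fun b hb => by
      have := h4 _ hb
      omega⟩

/-- A path that avoids a barrier does not cross it. -/
theorem not_cross (hB : IsBarrier p q B) (hpq : IsCoprime p q) {X : Set ℤ}
    (hX : ∀ b ∈ B, b ∉ X) {s t : ℤ} (hs : s ∈ X) (hst : LevelPath p q X s t) :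
    ¬ ((∀ b ∈ B, s < b) ∧ ∀ b ∈ B, b < t) ∧ ¬ ((∀ b ∈ B, t < b) ∧ ∀ b ∈ B, b < s) := by
  obtain ⟨ν, c₁, c₂, R, hne, h1, h2, h3, h4⟩ := hB
  obtain ⟨r, hr, hr1, hr2, -⟩ := exists_pos_step hpq
  have hν : ν s = ν t := by
    have key : t ∈ X ∧ ν s = ν t := by
      induction hst with
      | refl => exact ⟨hs, rfl⟩
      | tail _ h ih =>
        exact ⟨h.2, ih.2.trans (h1 _ _ h.1 (fun hb => hX _ hb ih.1) fun hb => hX _ hb h.2)⟩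
    exact key.2
  -- Steps of length `r` lead monotonically from `s` to `+∞` without meeting `B`.
  have up : ∀ s, (∀ b ∈ B, b < s) → ν s = c₁ := by
    intro s hs
    have hn : ∀ n : ℕ, ν s = ν (s + n * r) := by
      intro n
      induction n with
      | zero => simp
      | succ n ih =>
        have hnr : 0 ≤ n * r := by positivity
        rw [ih]
        refine h1 _ _ ?_ (fun hb => ?_) (fun hb => ?_)
        · convert hr1 (s + n * r) using 1
          push_cast; ring
        · have := hs _ hb
          omega
        · have := hs _ hb
          push_cast at this
          nlinarith
    rw [hn (R - s + 1).toNat]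
    refine h2 _ ?_
    have h5 := Int.self_le_toNat (R - s + 1)
    have h6 : ((R - s + 1).toNat : ℤ) ≤ (R - s + 1).toNat * r := by
      nlinarith [Int.natCast_nonneg (R - s + 1).toNat]
    omega
  have down : ∀ s, (∀ b ∈ B, s < b) → ν s = c₂ := by
    intro s hs
    have hn : ∀ n : ℕ, ν s = ν (s - n * r) := by
      intro n
      induction n with
      | zero => simp
      | succ n ih =>
        have hnr : 0 ≤ n * r := by positivity
        rw [ih]
        refine h1 _ _ ?_ (fun hb => ?_) (fun hb => ?_)
        · convert hr2 (s - n * r) using 1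
          push_cast; ring
        · have := hs _ hb
          omega
        · have := hs _ hb
          push_cast at this
          nlinarith
    rw [hn (R + s + 1).toNat]
    refine h3 _ ?_
    have h5 := Int.self_le_toNat (R + s + 1)
    have h6 : ((R + s + 1).toNat : ℤ) ≤ (R + s + 1).toNat * r := by
      nlinarith [Int.natCast_nonneg (R + s + 1).toNat]
    omega
  exact ⟨fun ⟨a, b⟩ => hne (by rw [← up t b, ← down s a, hν]),
    fun ⟨a, b⟩ => hne (by rw [← up s b, ← down t a, hν])⟩

theorem exists_greatest (hB : IsBarrier p q B) (hne : B.Nonempty) : ∃ m ∈ B, ∀ b ∈ B, b ≤ m := by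
  obtain ⟨ν, c₁, c₂, R, -, -, -, -, h4⟩ := hB
  exact Int.exists_greatest_of_bdd (P := (· ∈ B)) ⟨R, fun b hb => (h4 b hb).2⟩ hne

theorem exists_least (hB : IsBarrier p q B) (hne : B.Nonempty) : ∃ m ∈ B, ∀ b ∈ B, m ≤ b := by
  obtain ⟨ν, c₁, c₂, R, -, -, -, -, h4⟩ := hB
  exact Int.exists_least_of_bdd (P := (· ∈ B)) ⟨-R, fun b hb => (h4 b hb).1⟩ hne

end IsBarrier

/-! ### The profile along a barrier of harmonic levels -/

namespace IsProfile

variable {p q : ℤ} {θ : ℤ → ℤ} {B : Set ℤ}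

theorem slope_eq (hθ : IsProfile p q θ) (k : ℤ) : θ k = θ (k - 1) ∨ θ k = θ (k - 1) + 1 := by
  have h1 := hθ.toIsStep.le_succ (k - 1)
  have h2 := hθ.toIsStep.succ_le (k - 1)
  rw [sub_add_cancel] at h1 h2
  omega

/-- The Laplacian at `k` minus that at `k - 1` is the sum of the four slopes at the neighbours minus
four. It is nonnegative by superharmonicity and nonpositive since slopes are at most one, so
equality holds throughout. -/
theorem slope_one_spread (hθ : IsProfile p q θ) {k : ℤ} (hk : levelLap p q θ k = 0)
    (h : θ k = θ (k - 1) + 1) :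
    levelLap p q θ (k - 1) = 0 ∧ ∀ t, LevelStep p q k t → θ t = θ (t - 1) + 1 := by
  have h0 := hθ.superharmonic (k - 1)
  have i1 := hθ.slope_eq (k + p)
  have i2 := hθ.slope_eq (k - p)
  have i3 := hθ.slope_eq (k + q)
  have i4 := hθ.slope_eq (k - q)
  simp only [levelLap] at *
  rw [show k - 1 + p = k + p - 1 by ring, show k - 1 - p = k - p - 1 by ring,
    show k - 1 + q = k + q - 1 by ring, show k - 1 - q = k - q - 1 by ring] at *
  refine ⟨by omega, ?_⟩
  rintro t (rfl | rfl | rfl | rfl) <;> omega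

/-- The level just above the top of `B` has slope one, so slope-one levels connect it with `-∞`;
such a path would have to cross `B`, where the slope is zero. -/
theorem not_slope_zero_one (hθ : IsProfile p q θ) (hpq : IsCoprime p q) (hB : IsBarrier p q B)
    (hne : B.Nonempty) (h0 : ∀ b ∈ B, θ b = θ (b - 1)) (h1 : ∀ b ∈ B, θ (b + 1) = θ b + 1) :
    False := by
  obtain ⟨m, hm, hm'⟩ := hB.exists_greatest hne
  obtain ⟨m', hm1, hm1'⟩ := hB.exists_least hne
  have hs : θ (m + 1) = θ (m + 1 - 1) + 1 := by rw [add_sub_cancel_right]; exact h1 m hm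
  obtain ⟨j, hj, hpath⟩ := hθ.exists_path_of_slope_one hs m'
  refine (hB.not_cross hpq (X := {j | θ j = θ (j - 1) + 1}) (fun b hb hb' => ?_) hs hpath).2
    ⟨fun b hb => ?_, fun b hb => ?_⟩
  · have := h0 b hb
    have hb'' : θ b = θ (b - 1) + 1 := hb'
    omega
  · have := hm1' b hb
    omega
  · have := hm' b hb
    omega

theorem slope_one_of_path (hθ : IsProfile p q θ) (hlap : ∀ b ∈ B, levelLap p q θ b = 0) {s t : ℤ}
    (hs : s ∈ B) (h : LevelPath p q B s t) (h1 : θ s = θ (s - 1) + 1) : θ t = θ (t - 1) + 1 := by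
  have key : t ∈ B ∧ θ t = θ (t - 1) + 1 := by
    induction h with
    | refl => exact ⟨hs, h1⟩
    | tail _ h ih => exact ⟨h.2, (hθ.slope_one_spread (hlap _ ih.1) ih.2).2 _ h.1⟩
  exact key.2

/-- Push the barrier down one level at a time. Each translate is again harmonic and connected, so
its slope is one everywhere or zero everywhere; zero is excluded by `not_slope_zero_one`, as the
translate above has slope one. -/
theorem slope_one_below (hθ : IsProfile p q θ) (hpq : IsCoprime p q) (hB : IsBarrier p q B)
    (hconn : ∀ s ∈ B, ∀ t ∈ B, LevelPath p q B s t) (hlap : ∀ b ∈ B, levelLap p q θ b = 0)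
    (h1 : ∀ b ∈ B, θ b = θ (b - 1) + 1) (n : ℕ) :
    ∀ b ∈ B, levelLap p q θ (b - n) = 0 ∧ θ (b - n) = θ (b - n - 1) + 1 := by
  induction n with
  | zero => intro b hb; simpa using ⟨hlap b hb, h1 b hb⟩
  | succ n ih =>
    have hl : ∀ b ∈ B, levelLap p q θ (b - (n + 1 : ℕ)) = 0 := by
      intro b hb
      have := (hθ.slope_one_spread (ih b hb).1 (ih b hb).2).1
      push_cast
      rwa [← sub_sub]
    have hl' : ∀ b ∈ {b | b + ((n + 1 : ℕ) : ℤ) ∈ B}, levelLap p q θ b = 0 := by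
      intro b hb
      simpa only [add_sub_cancel_right] using hl _ hb
    intro b hb
    refine ⟨hl b hb, ?_⟩
    by_contra hcon
    refine hθ.not_slope_zero_one hpq (hB.shift (n + 1 : ℕ))
      ⟨b - (n + 1 : ℕ), by simpa using hb⟩ (fun c hc => ?_) fun c hc => ?_
    · refine (hθ.slope_eq c).resolve_right fun h => hcon ?_
      have hpath := (hconn _ hc b hb).shift ((n + 1 : ℕ) : ℤ)
      rw [add_sub_cancel_right] at hpath
      exact hθ.slope_one_of_path hl' hc hpath h
    · have := (ih _ hc).2
      rw [show c + ((n + 1 : ℕ) : ℤ) - n = c + 1 by push_cast; ring, add_sub_cancel_right] at this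
      exact this

/-- If a connected barrier of harmonic levels has slope one, then the profile is the identity
below it. -/
theorem exists_eq_self_of_slope_one (hθ : IsProfile p q θ) (hpq : IsCoprime p q)
    (hB : IsBarrier p q B) (hne : B.Nonempty)
    (hconn : ∀ s ∈ B, ∀ t ∈ B, LevelPath p q B s t) (hlap : ∀ b ∈ B, levelLap p q θ b = 0)
    (h1 : ∀ b ∈ B, θ b = θ (b - 1) + 1) : ∃ m ∈ B, ∀ s ≤ m, θ s = s := by
  have hid : ∀ b ∈ B, θ b = b := by
    intro b hb
    have hn : ∀ n : ℕ, θ b = θ (b - n) + n := by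
      intro n
      induction n with
      | zero => simp
      | succ n ih =>
        have := (hθ.slope_one_below hpq hB hconn hlap h1 n b hb).2
        rw [ih, this]
        push_cast
        rw [← sub_sub]; ring
    obtain ⟨R, hR0, hR1, -⟩ := hθ.exists_eq
    have h2 := hn (b + R).toNat
    have h3 := Int.self_le_toNat (b + R)
    rw [hR1 (b - ((b + R).toNat : ℤ)) (by omega)] at h2
    omega
  obtain ⟨m, hm, hm'⟩ := hB.exists_least hne
  obtain ⟨m₁, hm₁, hm₁'⟩ := hB.exists_greatest hne
  refine ⟨m, hm, fun s hs => ?_⟩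
  by_contra hcon
  have hlt : θ s < s := lt_of_le_of_ne (hθ.le_self s) hcon
  -- A level below the barrier with `θ s < s` would be joined to levels above it through such
  -- levels, but `θ` is the identity on `B`.
  obtain ⟨j, hj, hpath⟩ := hθ.exists_path_of_lt_self hlt m₁
  refine (hB.not_cross hpq (X := {j | θ j < j}) (fun b hb hb' => ?_) hlt hpath).1
    ⟨fun b hb => ?_, fun b hb => ?_⟩
  · exact absurd (hid b hb) (ne_of_lt hb')
  · rcases eq_or_lt_of_le hs with rfl | h
    · exact absurd (hid s hm) hcon
    · exact h.trans_le (hm' b hb)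
  · exact (hm₁' b hb).trans_lt hj

/-- Slope one at some `b` gives the first case. Otherwise the slope into `B` is zero everywhere: a
zero slope out of some `b` gives the second case by reflection, and slope one out of every `b` is
impossible by `not_slope_zero_one`. -/
theorem barrier_cases (hθ : IsProfile p q θ) (hpq : IsCoprime p q)
    (hB : IsBarrier p q B) (hne : B.Nonempty)
    (hconn : ∀ s ∈ B, ∀ t ∈ B, LevelPath p q B s t) (hlap : ∀ b ∈ B, levelLap p q θ b = 0) :
    (∃ m ∈ B, ∀ s ≤ m, θ s = s) ∨ ∃ m ∈ B, ∀ s, m ≤ s → θ s = 0 := by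
  by_cases h1 : ∃ b ∈ B, θ b = θ (b - 1) + 1
  · obtain ⟨b, hb, h1⟩ := h1
    exact Or.inl <| hθ.exists_eq_self_of_slope_one hpq hB hne hconn hlap fun c hc =>
      hθ.slope_one_of_path hlap hb (hconn b hb c hc) h1
  push Not at h1
  have h0 : ∀ b ∈ B, θ b = θ (b - 1) := fun b hb => (hθ.slope_eq b).resolve_right (h1 b hb)
  by_cases h2 : ∃ b ∈ B, θ (b + 1) = θ b
  · right
    obtain ⟨b, hb, h2⟩ := h2
    have hlap' : ∀ c ∈ {c | -c ∈ B}, levelLap p q θ c = 0 := fun c hc => by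
      rw [← hθ.levelLap_neg]; exact hlap _ hc
    have hconn' : ∀ s ∈ {c | -c ∈ B}, ∀ t ∈ {c | -c ∈ B}, LevelPath p q {c | -c ∈ B} s t := by
      intro s hs t ht
      have key : ∀ s t, LevelPath p q B s t → LevelPath p q {c | -c ∈ B} (-s) (-t) := by
        intro s t h
        induction h with
        | refl => exact Relation.ReflTransGen.refl
        | tail _ h ih =>
          exact Relation.ReflTransGen.tail ih ⟨h.1.neg, by simpa using h.2⟩
      simpa using key _ _ (hconn _ hs _ ht)
    have hb' : -b ∈ {c | -c ∈ B} := by simpa using hb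
    obtain ⟨m, hm, hm'⟩ := hθ.exists_eq_self_of_slope_one hpq hB.neg ⟨-b, hb'⟩ hconn' hlap'
      fun c hc => hθ.slope_one_of_path hlap' hb' (hconn' _ hb' c hc) (by
        have e := hθ.reflect (b + 1)
        rw [show -(b + 1) = -b - 1 by ring] at e
        rw [e, hθ.reflect, h2]; ring)
    refine ⟨-m, hm, fun s hs => ?_⟩
    have e1 := hm' (-s) (by omega)
    have e2 := hθ.reflect s
    omega
  · push Not at h2
    exact (hθ.not_slope_zero_one hpq hB hne h0 fun b hb => by
      have := h2 b hb
      have e := hθ.slope_eq (b + 1)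
      rw [add_sub_cancel_right] at e
      omega).elim

end IsProfile

/-! ### Crossing numbers: barriers from lattice paths -/

/-- Lattice paths whose vertices, except perhaps for the first one, lie in `X`. -/
def Linked (X : Set (ℤ × ℤ)) : ℤ × ℤ → ℤ × ℤ → Prop :=
  Relation.ReflTransGen fun v w => w ∈ nbrs v ∧ w ∈ X

theorem mem_nbrs {v w : ℤ × ℤ} : w ∈ nbrs v ↔ w = (v.1 + 1, v.2) ∨ w = (v.1 - 1, v.2) ∨
    w = (v.1, v.2 + 1) ∨ w = (v.1, v.2 - 1) := by
  simp [nbrs]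

theorem form_right (p q : ℤ) (v : ℤ × ℤ) : form p q (v.1 + 1, v.2) = form p q v + q := by
  simp only [form]; ring

theorem form_left (p q : ℤ) (v : ℤ × ℤ) : form p q (v.1 - 1, v.2) = form p q v - q := by
  simp only [form]; ring

theorem form_up (p q : ℤ) (v : ℤ × ℤ) : form p q (v.1, v.2 + 1) = form p q v - p := by
  simp only [form]; ring

theorem form_down (p q : ℤ) (v : ℤ × ℤ) : form p q (v.1, v.2 - 1) = form p q v + p := by
  simp only [form]; ring

theorem levelStep_of_mem_nbrs {p q : ℤ} {v w : ℤ × ℤ} (h : w ∈ nbrs v) :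
    LevelStep p q (form p q v) (form p q w) := by
  rcases mem_nbrs.1 h with rfl | rfl | rfl | rfl
  · rw [form_right]; exact Or.inr (Or.inr (Or.inl rfl))
  · rw [form_left]; exact Or.inr (Or.inr (Or.inr rfl))
  · rw [form_up]; exact Or.inr (Or.inl rfl)
  · rw [form_down]; exact Or.inl rfl

/-- The indicator of the levels met by the open horizontal ray that starts at the level `s`. -/
def rayIndicator (q s c : ℤ) : ℤ := if s < c ∧ q ∣ c - s then 1 else 0

theorem rayIndicator_add {q s c : ℤ} (hq : 0 < q) (h : c ≠ s) :
    rayIndicator q s (c + q) = rayIndicator q s c := by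
  have e : q ∣ c + q - s ↔ q ∣ c - s := by
    rw [show c + q - s = c - s + q by ring]; exact dvd_add_self_right
  simp only [rayIndicator, e]
  refine if_congr (and_congr_left fun hd => ⟨fun hlt => ?_, fun hlt => by omega⟩) rfl rfl
  have h1 : 0 < c - s + q := by omega
  have := Int.le_of_dvd h1 (dvd_add_self_right.2 hd)
  omega

theorem rayIndicator_sub_sub (q s c p : ℤ) :
    rayIndicator q (s - p) (c - p) = rayIndicator q s c := by
  simp only [rayIndicator, sub_lt_sub_iff_right, sub_sub_sub_cancel_right]

/-- The `q` starting levels represent every residue class modulo `q` once. -/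
theorem sum_rayIndicator {q s c : ℤ} (hq : 0 < q) (h : s + q ≤ c) :
    ∑ j ∈ Finset.range q.toNat, rayIndicator q (s + j) c = 1 := by
  have h0 := Int.emod_nonneg (c - s) hq.ne'
  have h1 := Int.emod_lt_of_pos (c - s) hq
  rw [Finset.sum_eq_single ((c - s) % q).toNat]
  · rw [rayIndicator, if_pos]
    rw [Int.toNat_of_nonneg h0]
    refine ⟨by omega, ?_⟩
    rw [← sub_sub]
    exact Int.dvd_self_sub_emod
  · intro j hj hne
    rw [rayIndicator, if_neg]
    rintro ⟨-, hd⟩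
    apply hne
    have hj' := Finset.mem_range.1 hj
    rw [← sub_sub] at hd
    have := Int.emod_eq_emod_iff_emod_sub_eq_zero.2 (Int.emod_eq_zero_of_dvd hd)
    rw [Int.emod_eq_of_lt (a := (j : ℤ)) (by omega) (by omega)] at this
    omega
  · intro hn
    simp only [Finset.mem_range] at hn
    omega

/-- The signed numbers of crossings of a lattice path with the horizontal rays. -/
theorem exists_crossing_number {p q R : ℤ} (hq : 0 < q) {K : Set (ℤ × ℤ)}
    (hR : ∀ v ∈ K, -R ≤ form p q v ∧ form p q v ≤ R) {a b : ℤ × ℤ} (ha : a ∈ K)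
    (hab : Linked K a b) :
    b ∈ K ∧ ∃ n : ℤ → ℤ, (∀ s, s + q ∉ form p q '' K → n (s + q) = n s) ∧
      (∀ s, s - p ∉ form p q '' K → n s - n (s - p) =
        rayIndicator q (s - p) (form p q b) - rayIndicator q (s - p) (form p q a)) ∧
      (∀ s, R ≤ s → n s = 0) ∧
      ∀ s, s + q ≤ -R → ∑ j ∈ Finset.range q.toNat, n (s + j) = b.2 - a.2 := by
  -- `n s` counts the vertical edges of the path whose lower end lies on a ray from level `s`,
  -- upward edges positively and downward ones negatively.
  induction hab with
  | refl => exact ⟨ha, fun _ => 0, by simp⟩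
  | @tail b c _ hbc ih =>
    obtain ⟨hb, n, h1, h2, h3, h4⟩ := ih
    obtain ⟨hn, hc⟩ := hbc
    refine ⟨hc, ?_⟩
    have hray : ∀ s, s + q ∉ form p q '' K → ∀ v ∈ K,
        rayIndicator q (s + q) (form p q v) = rayIndicator q s (form p q v) := by
      intro s hs v hv
      have e := rayIndicator_add (q := q) (s := s) (c := form p q v - q) hq
        fun h => hs ⟨v, hv, by omega⟩
      rw [sub_add_cancel] at e
      rw [e, ← rayIndicator_sub_sub q (s + q) _ q, add_sub_cancel_right]
    have hzero : ∀ s, R ≤ s → ∀ v ∈ K, rayIndicator q s (form p q v) = 0 := by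
      intro s hs v hv
      have := hR v hv
      rw [rayIndicator, if_neg (by omega)]
    have hone : ∀ s, s + q ≤ -R → ∀ v ∈ K,
        ∑ j ∈ Finset.range q.toNat, rayIndicator q (s + j) (form p q v) = 1 := by
      intro s hs v hv
      have := hR v hv
      exact sum_rayIndicator hq (by omega)
    rcases mem_nbrs.1 hn with rfl | rfl | rfl | rfl
    · refine ⟨n, h1, fun s hs => ?_, h3, h4⟩
      rw [h2 s hs, form_right, rayIndicator_add hq fun h => hs ⟨b, hb, h⟩]
    · refine ⟨n, h1, fun s hs => ?_, h3, h4⟩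
      have e := rayIndicator_add (q := q) (s := s - p) (c := form p q b - q) hq
        fun h => hs ⟨_, hc, by rw [form_left]; exact h⟩
      rw [h2 s hs, form_left, ← e, sub_add_cancel]
    · refine ⟨fun s => n s + rayIndicator q s (form p q b), fun s hs => ?_, fun s hs => ?_,
        fun s hs => ?_, fun s hs => ?_⟩
      · simp only [h1 s hs, hray s hs b hb]
      · have := h2 s hs
        simp only [form_up, rayIndicator_sub_sub] at this ⊢
        omega
      · simp only [h3 s hs, hzero s hs b hb, add_zero]
      · rw [Finset.sum_add_distrib, h4 s hs, hone s hs b hb]; ring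
    · refine ⟨fun s => n s - rayIndicator q s (form p q (b.1, b.2 - 1)), fun s hs => ?_,
        fun s hs => ?_, fun s hs => ?_, fun s hs => ?_⟩
      · simp only [h1 s hs, hray s hs _ hc]
      · have e := rayIndicator_sub_sub q s (form p q b + p) p
        have := h2 s hs
        rw [add_sub_cancel_right] at e
        simp only [form_down] at this ⊢
        omega
      · simp only [h3 s hs, hzero s hs _ hc, sub_zero]
      · rw [Finset.sum_sub_distrib, h4 s hs, hone s hs _ hc]; ring

/-- The potential is the crossing number `n`. Since the ends share a level, the end terms in its
vertical rule cancel and `n` is constant along steps off the levels of `K`. It is zero far up and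
constant far down; if that constant were zero, `a` and `b` would have equal heights and hence
coincide. -/
theorem isBarrier_of_pos {p q R : ℤ} (hpq : IsCoprime p q) (hq : 0 < q) {K : Set (ℤ × ℤ)}
    (hR : ∀ v ∈ K, -R ≤ form p q v ∧ form p q v ≤ R) {a b : ℤ × ℤ} (ha : a ∈ K)
    (hab : Linked K a b) (hne : a ≠ b) (hf : form p q a = form p q b) :
    IsBarrier p q (form p q '' K) := by
  obtain ⟨-, n, h1, h2, h3, h4⟩ := exists_crossing_number hq hR ha hab
  have hB : ∀ s ∈ form p q '' K, -R ≤ s ∧ s ≤ R := by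
    rintro s ⟨v, hv, rfl⟩
    exact hR v hv
  have hstep : ∀ s t, LevelStep p q s t → s ∉ form p q '' K → t ∉ form p q '' K →
      n s = n t := by
    have h2' : ∀ s, s - p ∉ form p q '' K → n s = n (s - p) := by
      intro s hs
      have := h2 s hs
      rw [hf] at this
      omega
    rintro s t (rfl | rfl | rfl | rfl) hs ht
    · simpa using (h2' (s + p) (by simpa using hs)).symm
    · exact h2' s ht
    · exact (h1 s ht).symm
    · simpa using h1 (s - q) (by simpa using hs)
  obtain ⟨S, hS0, hS⟩ := exists_window hpq
  have hp1 := neg_abs_le p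
  have hp2 := le_abs_self p
  have hR0 := hR a ha
  have hloc : ∀ s, s < -R - S - |p| - q → n (s - 1) = n s := by
    intro s hs
    refine (hS {j | n j = n s} s rfl fun j hj hjs => ?_).2
    have hjs' := abs_le.1 hjs
    have hout : ∀ t, t < -R → t ∉ form p q '' K := fun t ht h => by
      have := hB t h
      omega
    have hj' : n j = n s := hj
    have key : ∀ t, LevelStep p q j t → n t = n s := by
      intro t ht
      rw [← hj']
      refine (hstep j t ht (hout j (by omega)) (hout t ?_)).symm
      rcases ht with rfl | rfl | rfl | rfl <;> omega
    exact ⟨key _ (Or.inl rfl), key _ (Or.inr (Or.inl rfl)), key _ (Or.inr (Or.inr (Or.inl rfl))),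
      key _ (Or.inr (Or.inr (Or.inr rfl)))⟩
  set s₀ := -R - S - |p| - q - 1 with hs₀
  have hconst : ∀ s ≤ s₀, n s = n s₀ := by
    intro s hs
    induction s, hs using Int.leInductionDown with
    | base => rfl
    | pred s hs ih => rw [hloc s (by omega), ih]
  refine ⟨n, 0, n s₀, -s₀, ?_, hstep, fun s hs => h3 s (by omega),
    fun s hs => hconst s (by omega), fun s hs => by have := hB s hs; omega⟩
  intro h0
  have hsum := h4 (s₀ - q) (by omega)
  rw [Finset.sum_eq_zero fun j hj => by
    rw [hconst _ (by have := Finset.mem_range.1 hj; omega), ← h0]] at hsum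
  apply hne
  have e2 : a.2 = b.2 := by omega
  simp only [form, e2, sub_left_inj] at hf
  exact Prod.ext (mul_left_cancel₀ hq.ne' hf) e2

theorem form_neg_neg (p q : ℤ) (v : ℤ × ℤ) : form (-p) (-q) v = -form p q v := by
  simp only [form]; ring

theorem form_neg (p q : ℤ) (v : ℤ × ℤ) : form p q (-v) = -form p q v := by
  simp only [form, Prod.fst_neg, Prod.snd_neg]; ring

/-- The levels of a connected subset of a strip which has two vertices on the same level form a
barrier. -/
theorem isBarrier_levels {p q R : ℤ} (hpq : IsCoprime p q) {K : Set (ℤ × ℤ)}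
    (hR : ∀ v ∈ K, -R ≤ form p q v ∧ form p q v ≤ R) {a b : ℤ × ℤ} (ha : a ∈ K)
    (hab : Linked K a b) (hne : a ≠ b) (hf : form p q a = form p q b) :
    IsBarrier p q (form p q '' K) := by
  rcases lt_trichotomy q 0 with hq | rfl | hq
  · obtain ⟨ν, c₁, c₂, R, hne, h1, h2, h3, h4⟩ :=
      (isBarrier_of_pos (R := R) hpq.neg_neg (neg_pos.2 hq)
        (fun v hv => by have := hR v hv; rw [form_neg_neg]; omega) ha hab hne
        (by rw [form_neg_neg, form_neg_neg, hf])).neg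
    have e : {b | -b ∈ form (-p) (-q) '' K} = form p q '' K := by
      ext s
      simp [form_neg_neg]
    rw [e] at h1 h4
    exact ⟨ν, c₁, c₂, R, hne, fun s t hst => h1 s t (by
      simp only [LevelStep] at hst ⊢; omega), h2, h3, h4⟩
  -- Level steps are now `0` or `±1`, so the single level of `a` already separates.
  · have hp : p = 1 ∨ p = -1 := Int.isUnit_iff.1 (isCoprime_zero_right.1 hpq)
    have hRa := hR a ha
    refine ⟨fun s => if form p 0 a < s then 0 else 1, 0, 1, R, zero_ne_one, fun s t hst hs ht => ?_,
      fun s hs => if_pos (by omega), fun s hs => if_neg (by omega), ?_⟩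
    · have h1 : s ≠ form p 0 a := fun h => hs ⟨a, ha, h.symm⟩
      have h2 : t ≠ form p 0 a := fun h => ht ⟨a, ha, h.symm⟩
      refine if_congr ?_ rfl rfl
      simp only [LevelStep] at hst
      omega
    · rintro s ⟨v, hv, rfl⟩
      exact hR v hv
  · exact isBarrier_of_pos hpq hq hR ha hab hne hf

/-! ### Relaxation by the least action principle -/

/-- The Laplacian of the lattice `ℤ²`. -/
def lap (u : ℤ × ℤ → ℤ) (v : ℤ × ℤ) : ℤ :=
  u (v.1 + 1, v.2) + u (v.1 - 1, v.2) + u (v.1, v.2 + 1) + u (v.1, v.2 - 1) - 4 * u v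

theorem lap_add (u w : ℤ × ℤ → ℤ) (v : ℤ × ℤ) : lap (u + w) v = lap u v + lap w v := by
  simp only [lap, Pi.add_apply]; ring

theorem lap_sub (u w : ℤ × ℤ → ℤ) (v : ℤ × ℤ) : lap (u - w) v = lap u v - lap w v := by
  simp only [lap, Pi.sub_apply]; ring

theorem lap_le_of_le {u w : ℤ × ℤ → ℤ} {v : ℤ × ℤ} (h : ∀ x, u x ≤ w x) (hv : u v = w v) :
    lap u v ≤ lap w v := by
  simp only [lap, hv]
  have := h (v.1 + 1, v.2)
  have := h (v.1 - 1, v.2)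
  have := h (v.1, v.2 + 1)
  have := h (v.1, v.2 - 1)
  omega

theorem lap_single (v w : ℤ × ℤ) :
    lap (Pi.single v 1) w = if w = v then -4 else if v ∈ nbrs w then 1 else 0 := by
  obtain ⟨a, b⟩ := v
  obtain ⟨c, d⟩ := w
  simp only [lap, Pi.single_apply, mem_nbrs, Prod.mk.injEq]
  split_ifs <;> omega

theorem topple_eq (v : ℤ × ℤ) (φ : ℤ × ℤ → ℤ) : topple v φ = φ + lap (Pi.single v 1) := by
  funext w
  simp only [topple, Pi.add_apply, lap_single]
  split_ifs <;> omega

theorem topple_nonneg {v : ℤ × ℤ} {φ : ℤ × ℤ → ℤ} (h : IsState φ) (hv : 4 ≤ φ v) :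
    IsState (topple v φ) := by
  intro w
  have := h w
  simp only [topple]
  split_ifs with h1 h2
  · subst h1; omega
  · omega
  · omega

theorem exists_recurrent_enumeration :
    ∃ s : ℕ → ℤ × ℤ, ∀ v N, ∃ i, N ≤ i ∧ s i = v := by
  obtain ⟨e, he⟩ := exists_surjective_nat (ℤ × ℤ)
  refine ⟨fun i => e i.unpair.1, fun v N => ?_⟩
  obtain ⟨m, rfl⟩ := he v
  exact ⟨Nat.pair m N, Nat.right_le_pair m N, by simp⟩

theorem eventually_const_of_monotone {a : ℕ → ℤ} (ha : Monotone a) {c : ℤ} (hc : ∀ i, a i ≤ c) :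
    ∃ z N, ∀ i, N ≤ i → a i = z := by
  obtain ⟨z, ⟨N, hN⟩, hz⟩ := Int.exists_greatest_of_bdd (P := fun z => ∃ i, a i = z)
    ⟨c, by rintro z ⟨i, rfl⟩; exact hc i⟩ ⟨_, 0, rfl⟩
  exact ⟨z, N, fun i hi => le_antisymm (hz _ ⟨i, rfl⟩) (hN ▸ ha hi)⟩

open Classical in
/-- The odometer of the relaxation of `η` that topples the vertices of the sequence `s` whenever
this is legal. -/
noncomputable def odometer (η : ℤ × ℤ → ℤ) (s : ℕ → ℤ × ℤ) : ℕ → ℤ × ℤ → ℤ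
  | 0 => 0
  | i + 1 => if 4 ≤ η (s i) + lap (odometer η s i) (s i)
      then odometer η s i + Pi.single (s i) 1 else odometer η s i

theorem odometer_le_succ (η : ℤ × ℤ → ℤ) (s : ℕ → ℤ × ℤ) (i : ℕ) (v : ℤ × ℤ) :
    odometer η s i v ≤ odometer η s (i + 1) v := by
  simp only [odometer]
  split_ifs
  · simp only [Pi.add_apply, Pi.single_apply]
    split_ifs <;> omega
  · exact le_rfl

theorem odometer_mono (η : ℤ × ℤ → ℤ) (s : ℕ → ℤ × ℤ) (v : ℤ × ℤ) :
    Monotone fun i => odometer η s i v :=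
  monotone_nat_of_le_succ fun i => odometer_le_succ η s i v

/-- Where the odometer already equals `H`, its Laplacian is at most that of `H`, so the vertex is
stable and no toppling can take the odometer beyond `H`. -/
theorem odometer_le {η : ℤ × ℤ → ℤ} (s : ℕ → ℤ × ℤ) {H : ℤ × ℤ → ℤ} (hH0 : ∀ v, 0 ≤ H v)
    (hH : ∀ v, η v + lap H v ≤ 3) (i : ℕ) : ∀ v, odometer η s i v ≤ H v := by
  induction i with
  | zero => exact hH0
  | succ i ih =>
    intro v
    simp only [odometer]
    split_ifs with h
    · simp only [Pi.add_apply, Pi.single_apply]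
      split_ifs with hv
      · subst hv
        by_contra! hcon
        have := ih (s i)
        have := lap_le_of_le ih (v := s i) (by omega)
        have := hH (s i)
        omega
      · simpa using ih v
    · exact ih v

/-- The least action principle: if some nonnegative `H` stabilizes `η`, then `η` is relaxable, and
the odometer of a relaxation is bounded by every such `H`. -/
theorem exists_relaxation {η : ℤ × ℤ → ℤ} (hη : IsState η) {H : ℤ × ℤ → ℤ} (hH0 : ∀ v, 0 ≤ H v)
    (hH : ∀ v, η v + lap H v ≤ 3) :
    ∃ u : ℤ × ℤ → ℤ, (∀ v, 0 ≤ u v) ∧ (∀ v, u v ≤ H v) ∧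
      RelaxesTo η (fun v => η v + lap u v) := by
  obtain ⟨s, hs⟩ := exists_recurrent_enumeration
  have hlim : ∀ v, ∃ z N, ∀ i, N ≤ i → odometer η s i v = z := fun v =>
    eventually_const_of_monotone (odometer_mono η s v) fun i => odometer_le s hH0 hH i v
  choose u N hu using hlim
  have hlap : ∀ v, ∃ M, ∀ i, M ≤ i → odometer η s i v = u v ∧ lap (odometer η s i) v = lap u v := by
    intro v
    refine ⟨N v + N (v.1 + 1, v.2) + N (v.1 - 1, v.2) + N (v.1, v.2 + 1) + N (v.1, v.2 - 1),
      fun i hi => ⟨hu v i (by omega), ?_⟩⟩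
    simp only [lap]
    rw [hu v i (by omega), hu _ i (by omega), hu _ i (by omega), hu _ i (by omega),
      hu _ i (by omega)]
  have hstate : ∀ i, IsState (fun v => η v + lap (odometer η s i) v) := by
    intro i
    induction i with
    | zero => intro v; simpa [odometer, lap] using hη v
    | succ i ih =>
      simp only [odometer]
      split_ifs with h
      · convert topple_nonneg ih h using 1
        funext v
        simp only [topple_eq, lap_add, Pi.add_apply]
        ring
      · exact ih
  refine ⟨u, fun v => ?_, fun v => ?_, hη, ⟨fun v => ?_, fun v => ?_⟩,
    fun i v => η v + lap (odometer η s i) v, ⟨?_, fun i => ?_⟩, fun v => ?_⟩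
  · rw [← hu v _ le_rfl]
    exact odometer_mono η s v (Nat.zero_le _)
  · rw [← hu v _ le_rfl]
    exact odometer_le s hH0 hH _ v
  · obtain ⟨M, hM⟩ := hlap v
    have := hstate M v
    simp only [(hM M le_rfl).2] at this
    exact this
  · obtain ⟨M, hM⟩ := hlap v
    -- The sequence returns to `v` after the odometer has settled there; an unstable `v` would then
    -- topple once more.
    by_contra! hcon
    obtain ⟨i, hi, rfl⟩ := hs v M
    have h1 := (hM (i + 1) (by omega)).1
    simp only [odometer] at h1
    rw [if_pos (by rw [(hM i hi).2]; exact hcon)] at h1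
    have h2 := (hM i hi).1
    simp only [Pi.add_apply, Pi.single_eq_same] at h1
    omega
  · funext v
    simp [odometer, lap]
  · simp only [odometer]
    split_ifs with h
    · right
      refine ⟨s i, h, ?_⟩
      funext v
      simp only [topple_eq, lap_add, Pi.add_apply]
      ring
    · exact Or.inl rfl
  · obtain ⟨M, hM⟩ := hlap v
    exact ⟨M, fun i hi => by simp only [(hM i hi).2]⟩

/-! ### Lattice paths -/

theorem nbrs_symm {v w : ℤ × ℤ} (h : w ∈ nbrs v) : v ∈ nbrs w := lattice.symm.symm _ _ h

theorem Linked.mono {X Y : Set (ℤ × ℤ)} (hXY : X ⊆ Y) {a b : ℤ × ℤ} (h : Linked X a b) :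
    Linked Y a b := by
  induction h with
  | refl => exact Relation.ReflTransGen.refl
  | tail _ h ih => exact Relation.ReflTransGen.tail ih ⟨h.1, hXY h.2⟩

theorem Linked.mem {X : Set (ℤ × ℤ)} {a b : ℤ × ℤ} (h : Linked X a b) (ha : a ∈ X) : b ∈ X := by
  rcases Relation.ReflTransGen.cases_tail h with rfl | ⟨_, _, h⟩
  · exact ha
  · exact h.2

theorem Linked.trans {X : Set (ℤ × ℤ)} {a b c : ℤ × ℤ} (h : Linked X a b) (h' : Linked X b c) :
    Linked X a c :=
  Relation.ReflTransGen.trans h h'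

theorem Linked.symm {X : Set (ℤ × ℤ)} {a b : ℤ × ℤ} (h : Linked X a b) (ha : a ∈ X) :
    Linked X b a := by
  induction h with
  | refl => exact Relation.ReflTransGen.refl
  | tail h1 h2 ih =>
    exact Relation.ReflTransGen.head ⟨nbrs_symm h2.1, Linked.mem h1 ha⟩ ih

theorem neg_mem_nbrs {v w : ℤ × ℤ} (h : w ∈ nbrs v) : -w ∈ nbrs (-v) := by
  obtain ⟨a, b⟩ := v
  obtain ⟨c, d⟩ := w
  simp only [mem_nbrs, Prod.mk.injEq, Prod.neg_mk] at *
  omega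

theorem add_mem_nbrs {v w : ℤ × ℤ} (h : w ∈ nbrs v) (z : ℤ × ℤ) : w + z ∈ nbrs (v + z) := by
  obtain ⟨a, b⟩ := v
  obtain ⟨c, d⟩ := w
  obtain ⟨e, f⟩ := z
  simp only [mem_nbrs, Prod.mk.injEq, Prod.mk_add_mk] at *
  omega

theorem linked_univ (a b : ℤ × ℤ) : Linked Set.univ a b := by
  have hx : ∀ x x' y, Linked Set.univ (x, y) (x', y) := by
    intro x x' y
    refine mem_of_add_one (X := {x' | Linked Set.univ (x, y) (x', y)}) (a := x)
      Relation.ReflTransGen.refl (fun k hk => ⟨?_, ?_⟩) x'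
    · exact Relation.ReflTransGen.tail hk ⟨by simp [mem_nbrs], trivial⟩
    · exact Relation.ReflTransGen.tail hk ⟨by simp [mem_nbrs], trivial⟩
  have hy : ∀ x y y', Linked Set.univ (x, y) (x, y') := by
    intro x y y'
    refine mem_of_add_one (X := {y' | Linked Set.univ (x, y) (x, y')}) (a := y)
      Relation.ReflTransGen.refl (fun k hk => ⟨?_, ?_⟩) y'
    · exact Relation.ReflTransGen.tail hk ⟨by simp [mem_nbrs], trivial⟩
    · exact Relation.ReflTransGen.tail hk ⟨by simp [mem_nbrs], trivial⟩
  exact (hx a.1 b.1 a.2).trans (hy b.1 a.2 b.2)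

theorem form_add (p q : ℤ) (v w : ℤ × ℤ) : form p q (v + w) = form p q v + form p q w := by
  simp only [form, Prod.fst_add, Prod.snd_add]; ring

theorem form_sub (p q : ℤ) (v w : ℤ × ℤ) : form p q (v - w) = form p q v - form p q w := by
  simp only [form, Prod.fst_sub, Prod.snd_sub]; ring

theorem form_nsmul (p q : ℤ) (n : ℕ) (v : ℤ × ℤ) : form p q (n • v) = n * form p q v := by
  obtain ⟨x, y⟩ := v
  simp only [form, Prod.smul_mk, nsmul_eq_mul]; ring

/-- A unit step that increases the level most. -/
theorem exists_steepest {p q : ℤ} (hpq : IsCoprime p q) :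
    ∃ e : ℤ × ℤ, (∀ v, v + e ∈ nbrs v) ∧ 0 < form p q e ∧
      ∀ s t, LevelStep p q s t → s - form p q e ≤ t ∧ t ≤ s + form p q e := by
  obtain ⟨r, hr, h1, -, h3⟩ := exists_pos_step hpq
  rcases h1 0 with h | h | h | h
  · refine ⟨(0, -1), fun v => by simp [mem_nbrs, Prod.ext_iff, sub_eq_add_neg], ?_⟩
    have : form p q (0, -1) = r := by simp only [form]; omega
    rw [this]
    exact ⟨hr, h3⟩
  · refine ⟨(0, 1), fun v => by simp [mem_nbrs, Prod.ext_iff], ?_⟩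
    have : form p q (0, 1) = r := by simp only [form]; omega
    rw [this]
    exact ⟨hr, h3⟩
  · refine ⟨(1, 0), fun v => by simp [mem_nbrs, Prod.ext_iff], ?_⟩
    have : form p q (1, 0) = r := by simp only [form]; omega
    rw [this]
    exact ⟨hr, h3⟩
  · refine ⟨(-1, 0), fun v => by simp [mem_nbrs, Prod.ext_iff, sub_eq_add_neg], ?_⟩
    have : form p q (-1, 0) = r := by simp only [form]; omega
    rw [this]
    exact ⟨hr, h3⟩

theorem linked_add_nsmul {p q R : ℤ} {e : ℤ × ℤ} (he : ∀ v, v + e ∈ nbrs v)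
    (he0 : 0 < form p q e) {a : ℤ × ℤ} (ha : R < form p q a) (n : ℕ) :
    Linked {v | R < form p q v} a (a + n • e) := by
  induction n with
  | zero =>
    rw [zero_nsmul, add_zero]
    exact Relation.ReflTransGen.refl
  | succ n ih =>
    refine Relation.ReflTransGen.tail ih ⟨?_, ?_⟩
    · rw [succ_nsmul, ← add_assoc]
      exact he _
    · change R < form p q _
      rw [form_add, form_nsmul]
      have : 0 ≤ ((n + 1 : ℕ) : ℤ) * form p q e := by positivity
      omega

/-- Half-planes are connected. -/
theorem linked_halfPlane {p q R : ℤ} (hpq : IsCoprime p q) {a b : ℤ × ℤ} (ha : R < form p q a)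
    (hb : R < form p q b) : Linked {v | R < form p q v} a b := by
  obtain ⟨e, he, he0, -⟩ := exists_steepest hpq
  -- Any lattice path from `a` lies in the half-plane after translation by a large multiple of `e`;
  -- its ends are joined to `a` and `b` along `e`.
  have key : ∀ c, ∃ n₀ : ℕ, ∀ n ≥ n₀, R < form p q (c + n • e) ∧
      Linked {v | R < form p q v} (a + n • e) (c + n • e) := by
    intro c
    have hc := linked_univ a c
    induction hc with
    | refl =>
      refine ⟨0, fun n _ => ⟨?_, Relation.ReflTransGen.refl⟩⟩
      rw [form_add, form_nsmul]
      have : 0 ≤ (n : ℤ) * form p q e := by positivity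
      omega
    | @tail c d _ h ih =>
      obtain ⟨n₀, hn₀⟩ := ih
      refine ⟨max n₀ (R - form p q d + 1).toNat, fun n hn => ?_⟩
      have hd : R < form p q (d + n • e) := by
        rw [form_add, form_nsmul]
        have h1 : (n : ℤ) ≤ n * form p q e := by nlinarith [Int.natCast_nonneg n]
        omega
      exact ⟨hd, Relation.ReflTransGen.tail (hn₀ n (by omega)).2 ⟨add_mem_nbrs h.1 _, hd⟩⟩
  obtain ⟨n, hn⟩ := key b
  exact ((linked_add_nsmul he he0 ha n).trans (hn n le_rfl).2).trans
    ((linked_add_nsmul he he0 hb n).symm hb)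

theorem reachable_of_linked {X T : Set (ℤ × ℤ)} (hT : ∀ v ∈ T, ∀ w ∈ nbrs v, w ∈ X → w ∈ T)
    {a b : ℤ × ℤ} (ha : a ∈ T) (h : Linked X a b) :
    ∃ hb : b ∈ T, (lattice.induce T).Reachable ⟨a, ha⟩ ⟨b, hb⟩ := by
  induction h with
  | refl => exact ⟨ha, SimpleGraph.Reachable.refl _⟩
  | tail _ h ih =>
    obtain ⟨hb, hr⟩ := ih
    refine ⟨hT _ hb _ h.1 h.2, hr.trans (SimpleGraph.Adj.reachable ?_)⟩
    exact h.1

theorem linked_of_connected {T : Set (ℤ × ℤ)} (hT : (lattice.induce T).Connected)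
    {a b : ℤ × ℤ} (ha : a ∈ T) (hb : b ∈ T) : Linked T a b := by
  obtain ⟨w⟩ := hT.preconnected ⟨a, ha⟩ ⟨b, hb⟩
  have key : ∀ x y : T, (lattice.induce T).Walk x y → Linked T x y := by
    intro x y w
    induction w with
    | nil => exact Relation.ReflTransGen.refl
    | cons h _ ih => exact Relation.ReflTransGen.head ⟨h, Subtype.property _⟩ ih
  exact key _ _ w

theorem levelPath_of_linked {p q : ℤ} {K : Set (ℤ × ℤ)} {a b : ℤ × ℤ} (h : Linked K a b) :
    LevelPath p q (form p q '' K) (form p q a) (form p q b) := by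
  induction h with
  | refl => exact Relation.ReflTransGen.refl
  | tail _ h ih =>
    exact Relation.ReflTransGen.tail ih ⟨levelStep_of_mem_nbrs h.1, ⟨_, h.2, rfl⟩⟩

/-- The state with the Laplacian of a function of the level. -/
def levelState (p q : ℤ) (θ : ℤ → ℤ) (v : ℤ × ℤ) : ℤ := 3 + levelLap p q θ (form p q v)

/-- The vertices with three grains that are connected with vertices of arbitrarily high level. -/
def upperTerritory (p q : ℤ) (φ : ℤ × ℤ → ℤ) : Set (ℤ × ℤ) :=
  {v | φ v = 3 ∧ ∀ r, ∃ b, r < form p q b ∧ Linked {w | φ w = 3} v b}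

theorem lap_comp_form (p q : ℤ) (g : ℤ → ℤ) (v : ℤ × ℤ) :
    lap (fun v => g (form p q v)) v = levelLap p q g (form p q v) := by
  simp only [lap, levelLap, form_right, form_left, form_up, form_down]
  ring

theorem lap_shift_comp_form (p q : ℤ) (g : ℤ → ℤ) (n : ℤ) (v : ℤ × ℤ) :
    lap (fun v => g (form p q v - n) + n) v = levelLap p q g (form p q v - n) := by
  refine (lap_comp_form p q (fun k => g (k - n) + n) v).trans ?_
  simpa only [← sub_eq_add_neg] using levelLap_shift p q g (-n) n (form p q v)

/-! ### Components of the set of vertices with three grains -/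

section Territory

variable {p q R : ℤ} {φ : ℤ × ℤ → ℤ}

theorem upperTerritory_closed {v w : ℤ × ℤ} (hv : v ∈ upperTerritory p q φ) (hw : w ∈ nbrs v)
    (h : φ w = 3) : w ∈ upperTerritory p q φ := by
  refine ⟨h, fun r => ?_⟩
  obtain ⟨b, hb, hvb⟩ := hv.2 r
  exact ⟨b, hb, Relation.ReflTransGen.head ⟨nbrs_symm hw, hv.1⟩ hvb⟩

theorem upperTerritory_of_linked {v w : ℤ × ℤ} (hv : v ∈ upperTerritory p q φ)
    (h : Linked {w | φ w = 3} v w) : w ∈ upperTerritory p q φ := by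
  induction h with
  | refl => exact hv
  | tail _ h ih => exact upperTerritory_closed ih h.1 h.2

theorem mem_upperTerritory (hpq : IsCoprime p q) (hR : ∀ v, R < form p q v → φ v = 3)
    {v : ℤ × ℤ} (hv : R < form p q v) : v ∈ upperTerritory p q φ := by
  refine ⟨hR v hv, fun r => ?_⟩
  obtain ⟨e, he, he0, -⟩ := exists_steepest hpq
  refine ⟨v + (r - form p q v + 1).toNat • e, ?_, (linked_add_nsmul he he0 hv _).mono hR⟩
  rw [form_add, form_nsmul]
  have h1 := Int.self_le_toNat (r - form p q v + 1)
  have h2 : ((r - form p q v + 1).toNat : ℤ) ≤ (r - form p q v + 1).toNat * form p q e := by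
    nlinarith [Int.natCast_nonneg (r - form p q v + 1).toNat]
  omega

theorem linked_upperTerritory (hpq : IsCoprime p q) (hR : ∀ v, R < form p q v → φ v = 3)
    {a b : ℤ × ℤ} (ha : a ∈ upperTerritory p q φ) (hb : b ∈ upperTerritory p q φ) :
    Linked {w | φ w = 3} a b := by
  obtain ⟨a', ha', haa'⟩ := ha.2 R
  obtain ⟨b', hb', hbb'⟩ := hb.2 R
  exact (haa'.trans ((linked_halfPlane hpq ha' hb').mono hR)).trans (hbb'.symm hb.1)

theorem upperTerritory_infinite (hpq : IsCoprime p q) (hR : ∀ v, R < form p q v → φ v = 3) :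
    (upperTerritory p q φ).Infinite := by
  obtain ⟨e, he, he0, -⟩ := exists_steepest hpq
  refine Set.infinite_of_injective_forall_mem (f := fun n : ℕ => (R.toNat + 1 + n) • e)
    (fun m n hmn => ?_) fun n => mem_upperTerritory hpq hR ?_
  · have h := congrArg (form p q) hmn
    simp only [form_nsmul] at h
    have := mul_right_cancel₀ he0.ne' h
    omega
  · rw [form_nsmul]
    have h1 := Int.self_le_toNat R
    push_cast
    nlinarith [Int.natCast_nonneg R.toNat, Int.natCast_nonneg n]

theorem isTerritory_upperTerritory (hpq : IsCoprime p q) (hφ : ∀ v, φ v ≤ 3)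
    (hR : ∀ v, R < form p q v → φ v = 3) : IsTerritory φ (upperTerritory p q φ) where
  connected := by
    have hne := (upperTerritory_infinite hpq hR).nonempty
    refine @SimpleGraph.Connected.mk _ _ (fun a b => ?_) hne.to_subtype
    exact (reachable_of_linked (X := {w | φ w = 3}) (fun v hv w hw h =>
      upperTerritory_closed hv hw h) a.2 (linked_upperTerritory hpq hR a.2 b.2)).2
  eq_three v hv := hv.1
  lt_three w hw := by
    rintro ⟨v, hvw, hv⟩
    refine lt_of_le_of_ne (hφ w) fun h => hw (upperTerritory_closed hv (nbrs_symm hvw) h)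
  nontrivial := (upperTerritory_infinite hpq hR).nontrivial

theorem IsTerritory.mem_of_linked {T : Set (ℤ × ℤ)} (hT : IsTerritory φ T)
    {v w : ℤ × ℤ} (hv : v ∈ T) (h : Linked {w | φ w = 3} v w) : w ∈ T := by
  induction h with
  | refl => exact hv
  | tail _ h ih =>
    by_contra hcon
    exact (hT.lt_three _ hcon ⟨_, nbrs_symm h.1, ih⟩).ne h.2

theorem IsTerritory.eq_upperTerritory {T : Set (ℤ × ℤ)} (hT : IsTerritory φ T)
    (hpq : IsCoprime p q) (hR : ∀ v, R < form p q v → φ v = 3) {v : ℤ × ℤ} (hv : v ∈ T)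
    (hvR : R < form p q v) : T = upperTerritory p q φ := by
  have hvU := mem_upperTerritory hpq hR hvR
  refine Set.Subset.antisymm (fun w hw => ?_) fun w hw => ?_
  · exact upperTerritory_of_linked hvU
      ((linked_of_connected hT.connected hv hw).mono hT.eq_three)
  · exact hT.mem_of_linked hv (linked_upperTerritory hpq hR hvU hw)

theorem neg_upperTerritory (hφ : ∀ v, φ (-v) = φ v) :
    -upperTerritory p q φ = upperTerritory (-p) (-q) φ := by
  have hlink : ∀ a b, Linked {w | φ w = 3} a b → Linked {w | φ w = 3} (-a) (-b) := by
    intro a b h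
    induction h with
    | refl => exact Relation.ReflTransGen.refl
    | tail _ h ih =>
      exact Relation.ReflTransGen.tail ih ⟨neg_mem_nbrs h.1, (hφ _).trans h.2⟩
  ext v
  rw [Set.mem_neg]
  constructor
  · rintro ⟨h1, h2⟩
    refine ⟨(hφ v).symm.trans h1, fun r => ?_⟩
    obtain ⟨b, hb, hvb⟩ := h2 r
    exact ⟨-b, by rwa [form_neg, form_neg_neg, neg_neg], by simpa using hlink _ _ hvb⟩
  · rintro ⟨h1, h2⟩
    refine ⟨(hφ v).trans h1, fun r => ?_⟩
    obtain ⟨b, hb, hvb⟩ := h2 r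
    exact ⟨-b, by rwa [form_neg, ← form_neg_neg], hlink _ _ hvb⟩

end Territory

/-! ### The state of a profile -/

namespace IsProfile

variable {p q : ℤ} {θ : ℤ → ℤ}

theorem levelState_le (hθ : IsProfile p q θ) (v : ℤ × ℤ) : levelState p q θ v ≤ 3 := by
  have := hθ.superharmonic (form p q v)
  simp only [levelState]
  omega

theorem levelState_stable (hθ : IsProfile p q θ) : IsStable (levelState p q θ) := by
  refine ⟨fun v => ?_, fun v => ?_⟩
  · have := hθ.neg_three_le (form p q v)
    simp only [levelState]
    omega
  · have := hθ.levelState_le v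
    omega

theorem levelState_eq_three_iff {v : ℤ × ℤ} :
    levelState p q θ v = 3 ↔ levelLap p q θ (form p q v) = 0 := by
  simp only [levelState]
  omega

theorem levelState_neg (hθ : IsProfile p q θ) (v : ℤ × ℤ) :
    levelState p q θ (-v) = levelState p q θ v := by
  rw [levelState, form_neg, hθ.levelLap_neg, levelState]

theorem levelState_neg_neg (hθ : IsProfile p q θ) :
    levelState (-p) (-q) θ = levelState p q θ := by
  funext v
  rw [levelState, form_neg_neg, levelState, ← hθ.levelLap_neg]
  simp only [levelLap, sub_neg_eq_add, ← sub_eq_add_neg]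
  ring

theorem levelLap_eq_zero_of_le {m r k : ℤ} (hr : ∀ s t, LevelStep p q s t → s - r ≤ t ∧ t ≤ s + r)
    (h : ∀ s ≤ m, θ s = s) (hr0 : 0 ≤ r) (hk : k + r ≤ m) : levelLap p q θ k = 0 := by
  have h1 := hr k _ (Or.inl rfl)
  have h2 := hr k _ (Or.inr (Or.inl rfl))
  have h3 := hr k _ (Or.inr (Or.inr (Or.inl rfl)))
  have h4 := hr k _ (Or.inr (Or.inr (Or.inr rfl)))
  simp only [levelLap]
  rw [h _ (by omega), h _ (by omega), h _ (by omega), h _ (by omega), h _ (by omega)]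
  ring

theorem exists_levelState_eq_three (hθ : IsProfile p q θ) (hpq : IsCoprime p q) :
    ∃ R, 0 ≤ R ∧ ∀ v, R < |form p q v| → levelState p q θ v = 3 := by
  obtain ⟨R, hR0, hR1, hR2⟩ := hθ.exists_eq
  obtain ⟨r, hr, -, -, hr'⟩ := exists_pos_step hpq
  have key : ∀ k, k + r ≤ -R → levelLap p q θ k = 0 := fun k hk =>
    levelLap_eq_zero_of_le hr' hR1 hr.le hk
  refine ⟨R + r, by omega, fun v hv => levelState_eq_three_iff.2 ?_⟩
  rcases lt_abs.1 hv with h | h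
  · rw [← hθ.levelLap_neg]
    exact key _ (by omega)
  · exact key _ (by omega)

/-- The profile vanishes on the upper territory, by the maximum principle. -/
theorem eq_zero_of_mem (hθ : IsProfile p q θ) {v : ℤ × ℤ}
    (hv : v ∈ upperTerritory p q (levelState p q θ)) : θ (form p q v) = 0 := by
  obtain ⟨R, -, -, hR2⟩ := hθ.exists_eq
  obtain ⟨b, hb, hvb⟩ := hv.2 R
  have hb3 : levelState p q θ b = 3 := hvb.mem hv.1
  have hbv := hvb.symm hv.1
  have key : ∀ w, Linked {w | levelState p q θ w = 3} b w →
      θ (form p q w) = 0 := by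
    intro w hw
    induction hw with
    | refl => exact hR2 _ hb.le
    | @tail c d hc hd ih =>
      have h0 := levelState_eq_three_iff.1 (Linked.mem hc hb3)
      have h1 := hθ.le_zero (form p q c + p)
      have h2 := hθ.le_zero (form p q c - p)
      have h3 := hθ.le_zero (form p q c + q)
      have h4 := hθ.le_zero (form p q c - q)
      simp only [levelLap] at h0
      rcases levelStep_of_mem_nbrs (p := p) (q := q) hd.1 with e | e | e | e <;> rw [e] <;> omega
  exact key v hbv

/-- Since `θ` vanishes here and `θ k ≤ k`, the level is nonnegative. At level zero harmonicity would
make `θ` vanish at level `-r` too. -/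
theorem form_pos_of_mem (hθ : IsProfile p q θ) (hpq : IsCoprime p q) {v : ℤ × ℤ}
    (hv : v ∈ upperTerritory p q (levelState p q θ)) : 0 < form p q v := by
  have h0 := hθ.eq_zero_of_mem hv
  have hle := hθ.le_self (form p q v)
  refine lt_of_le_of_ne (by omega) fun h => ?_
  have hl := levelState_eq_three_iff.1 hv.1
  obtain ⟨r, hr, -, hr2, -⟩ := exists_pos_step hpq
  have hlt := hθ.le_self (form p q v - r)
  have h1 := hθ.le_zero (form p q v + p)
  have h2 := hθ.le_zero (form p q v - p)
  have h3 := hθ.le_zero (form p q v + q)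
  have h4 := hθ.le_zero (form p q v - q)
  simp only [levelLap] at hl
  rcases hr2 (form p q v) with e | e | e | e <;> rw [e] at hlt <;> omega

/-- The slope of the profile vanishes on the upper territory. -/
theorem slope_zero_of_mem (hθ : IsProfile p q θ) {v : ℤ × ℤ}
    (hv : v ∈ upperTerritory p q (levelState p q θ)) :
    θ (form p q v) = θ (form p q v - 1) := by
  refine (hθ.slope_eq _).resolve_right fun h1 => ?_
  obtain ⟨R, -, -, hR2⟩ := hθ.exists_eq
  obtain ⟨b, hb, hvb⟩ := hv.2 R
  have key : ∀ w, Linked {w | levelState p q θ w = 3} v w →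
      θ (form p q w) = θ (form p q w - 1) + 1 := by
    intro w hw
    induction hw with
    | refl => exact h1
    | tail hc hd ih =>
      exact (hθ.slope_one_spread (levelState_eq_three_iff.1 (Linked.mem hc hv.1)) ih).2 _
        (levelStep_of_mem_nbrs hd.1)
  have := key b hvb
  rw [hR2 _ hb.le, hR2 _ (by omega)] at this
  omega

/-- Otherwise the ray from `v` in direction `-e` would stay in the territory and reach nonpositive
levels. -/
theorem exists_level_below (hθ : IsProfile p q θ) (hpq : IsCoprime p q) {v : ℤ × ℤ}
    (hv : v ∈ upperTerritory p q (levelState p q θ)) :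
    ∃ n, 0 ≤ n ∧ levelLap p q θ (form p q v - n) < 0 := by
  by_contra! hcon
  obtain ⟨e, he, he0, -⟩ := exists_steepest hpq
  have key : ∀ n : ℕ, v - n • e ∈ upperTerritory p q (levelState p q θ) := by
    intro n
    induction n with
    | zero => simpa using hv
    | succ n ih =>
      refine upperTerritory_closed ih ?_ ?_
      · refine nbrs_symm ?_
        convert he (v - (n + 1) • e) using 1
        rw [succ_nsmul]; abel
      · rw [levelState_eq_three_iff, form_sub, form_nsmul]
        exact le_antisymm (hθ.superharmonic _) (hcon _ (by positivity))
  have h1 := hθ.form_pos_of_mem hpq (key (form p q v).toNat)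
  rw [form_sub, form_nsmul] at h1
  have h2 := Int.self_le_toNat (form p q v)
  nlinarith [Int.natCast_nonneg (form p q v).toNat]

/-- Toppling `θ(F - n) + n - θ(F)` translates the state by `n` levels; `n` is chosen so that the
translated state has fewer than three grains at `v`, leaving room for the added one. -/
theorem relaxable (hθ : IsProfile p q θ) (hpq : IsCoprime p q) {v : ℤ × ℤ}
    (hv : v ∈ upperTerritory p q (levelState p q θ)) :
    Relaxable (levelState p q θ + Pi.single v 1) := by
  obtain ⟨n, hn, hlt⟩ := hθ.exists_level_below hpq hv
  have hst : IsState (levelState p q θ + Pi.single v 1) := by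
    intro w
    have := hθ.levelState_stable.1 w
    simp only [Pi.add_apply, Pi.single_apply]
    split_ifs <;> omega
  obtain ⟨u, -, -, hu⟩ := exists_relaxation hst
    (H := (fun w => θ (form p q w - n) + n) - fun w => θ (form p q w))
    (fun w => by
      have := hθ.toIsStep.sub_le_of_le (a := form p q w - n) (b := form p q w) (by omega)
      simp only [Pi.sub_apply]
      omega) (fun w => by
      rw [lap_sub, lap_comp_form, lap_shift_comp_form]
      simp only [Pi.add_apply, levelState, Pi.single_apply]
      split_ifs with hw
      · subst hw; omega
      · have := hθ.superharmonic (form p q w - n)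
        omega)
  exact ⟨_, hu⟩

end IsProfile

/-! ### Waves and infinite territories -/

theorem lap_indicator (A : Finset (ℤ × ℤ)) (w : ℤ × ℤ) :
    ∑ u ∈ A, lap (Pi.single u 1) w = lap (fun x => if x ∈ A then 1 else 0) w := by
  simp only [lap, Finset.sum_sub_distrib, Finset.sum_add_distrib, ← Finset.mul_sum,
    Pi.single_apply, Finset.sum_ite_eq]

theorem not_mem_nbrs_self (v : ℤ × ℤ) : v ∉ nbrs v := lattice.loopless.irrefl v

open Classical in
/-- The start of a wave is obtained by toppling the vertex `v` and its neighbours in `T`. -/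
theorem waveStart_eq {φ : ℤ × ℤ → ℤ} {T : Set (ℤ × ℤ)} (h3 : ∀ w ∈ T, φ w = 3) (v : ℤ × ℤ) :
    waveStart φ T v = φ + lap (Pi.single v 1 +
      fun x => if x ∈ (nbrs v).filter (· ∈ T) then 1 else 0) := by
  have hA : ((nbrs v).filter fun u => u ∈ T ∧ 4 ≤ topple v (φ + Pi.single v 1) u) =
      (nbrs v).filter (· ∈ T) := by
    refine Finset.filter_congr fun u hu => and_iff_left_of_imp fun huT => ?_
    have hne : u ≠ v := fun h => not_mem_nbrs_self v (h ▸ hu)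
    simp only [topple, if_neg hne, if_pos (nbrs_symm hu), Pi.add_apply, Pi.single_apply, h3 u huT]
    norm_num
  funext w
  simp only [waveStart, hA, Pi.add_apply, Pi.sub_apply, Finset.sum_apply, lap_add]
  rw [← lap_indicator]
  simp only [topple_eq, Pi.add_apply, add_sub_cancel_left]
  ring

theorem lap_pos_of_mem {u : ℤ × ℤ → ℤ} (hu : ∀ x, 0 ≤ u x) {v w : ℤ × ℤ} (hw : w ∈ nbrs v) :
    u w ≤ lap u v + 4 * u v := by
  simp only [lap]
  have := hu (v.1 + 1, v.2)
  have := hu (v.1 - 1, v.2)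
  have := hu (v.1, v.2 + 1)
  have := hu (v.1, v.2 - 1)
  rcases mem_nbrs.1 hw with rfl | rfl | rfl | rfl <;> omega

namespace IsProfile

variable {p q : ℤ} {θ : ℤ → ℤ}

/-- A function between zero and the toppling function of the wave that equals one on the upper
territory and does not destabilize the state is the toppling function of the wave. -/
theorem wave_le (hθ : IsProfile p q θ) (hpq : IsCoprime p q) {u : ℤ × ℤ → ℤ}
    (hu0 : ∀ x, 0 ≤ u x) (hu1 : ∀ x, u x ≤ 1)
    (huT : ∀ x ∈ upperTerritory p q (levelState p q θ), u x = 1)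
    (hu : ∀ x, levelState p q θ x + lap u x ≤ 3) (x : ℤ × ℤ) :
    θ (form p q x - 1) + 1 - θ (form p q x) ≤ u x := by
  classical
  obtain ⟨R, hR0, hR1, hR2⟩ := hθ.exists_eq
  obtain ⟨R', hR'0, hR'⟩ := hθ.exists_levelState_eq_three hpq
  have hsurj : ∀ k, ∃ x, form p q x = k := by
    intro k
    obtain ⟨a, b, hab⟩ := hpq
    exact ⟨(k * b, -(k * a)), by simp only [form]; linear_combination k * hab⟩
  -- The minimum of `u` over a level, since `u` need not be a function of the level. At a vertex
  -- where it is attained, the Laplacian of `m` is at most that of `u`.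
  let m : ℤ → ℤ := fun k => if ∀ x, form p q x = k → u x = 1 then 1 else 0
  have hm : ∀ x, m (form p q x) ≤ u x := by
    intro x
    simp only [m]
    split_ifs with h
    · exact (h x rfl).ge
    · exact hu0 x
  have hatt : ∀ k, ∃ x, form p q x = k ∧ u x = m k := by
    intro k
    simp only [m]
    split_ifs with h
    · obtain ⟨x, hx⟩ := hsurj k
      exact ⟨x, hx, h x hx⟩
    · push Not at h
      obtain ⟨x, hx, hne⟩ := h
      have := hu0 x
      have := hu1 x
      exact ⟨x, hx, by omega⟩
  have key := hθ.le_shift (g := fun k => θ k + m k) (fun k => by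
    obtain ⟨x, rfl, hx⟩ := hatt k
    have h1 := hu x
    have h2 := lap_le_of_le (u := fun x => m (form p q x)) (w := u) hm hx.symm
    rw [lap_comp_form] at h2
    simp only [levelState] at h1
    simp only [levelLap] at *
    omega) 1 ⟨max R R' + 1, fun k hk => by
      have hm0 : 0 ≤ m k := by simp only [m]; split_ifs <;> omega
      rcases le_abs.1 hk with h | h
      · have : m k = 1 := if_pos fun x hx => huT x <| mem_upperTerritory hpq
          (R := R') (fun v hv => hR' v (lt_of_lt_of_le hv (le_abs_self _))) (by omega)
        rw [hR2 k (by omega), this]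
        omega
      · rw [hR1 k (by omega)]
        omega⟩ (form p q x)
  have := hm x
  omega

/-- `I` records the initial topplings and `H` those that translate the state by one level. The
remaining relaxation `u` is at most `H - I` by least action, and `wave_le` bounds `u + I` below by
`H`. -/
theorem waveEq (hθ : IsProfile p q θ) (hpq : IsCoprime p q) {w : ℤ × ℤ} (hw : form p q w = 1) :
    WaveEq (levelState p q θ) (upperTerritory p q (levelState p q θ))
      (fun v => levelState p q θ (v - w)) := by
  classical
  obtain ⟨R, hR0, hR⟩ := hθ.exists_levelState_eq_three hpq
  have hR' : ∀ v, R < form p q v → levelState p q θ v = 3 := fun v hv =>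
    hR v (lt_of_lt_of_le hv (le_abs_self _))
  set φ := levelState p q θ with hφ
  set T := upperTerritory p q φ with hT
  refine ⟨isTerritory_upperTerritory hpq hθ.levelState_le hR', fun v hv =>
    ⟨hθ.relaxable hpq hv, ?_⟩⟩
  set A := (nbrs v).filter (· ∈ T) with hA
  set I : ℤ × ℤ → ℤ := Pi.single v 1 + fun x => if x ∈ A then 1 else 0 with hI
  rw [waveStart_eq (fun w hw => hw.1), ← hA, ← hI]
  have hAT : ∀ x ∈ A, x ∈ nbrs v ∧ x ∈ T := fun x hx => by simpa [hA] using hx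
  have hIv : I v = 1 := by
    have : v ∉ A := fun h => not_mem_nbrs_self v (hAT v h).1
    simp [hI, this]
  have hIA : ∀ x ∈ A, I x = 1 := by
    intro x hx
    have : x ≠ v := fun h => not_mem_nbrs_self v (h ▸ (hAT x hx).1)
    simp [hI, this, hx]
  have hIn : ∀ x, x ≠ v → x ∉ A → I x = 0 := fun x h1 h2 => by simp [hI, h1, h2]
  have hI0 : ∀ x, 0 ≤ I x := by
    intro x
    by_cases h1 : x = v
    · rw [h1, hIv]; omega
    · by_cases h2 : x ∈ A
      · rw [hIA x h2]; omega
      · rw [hIn x h1 h2]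
  -- Toppling `v` and removing the grain leaves `-1` there; a toppled neighbour is needed to return
  -- to a nonnegative state.
  obtain ⟨c, hc⟩ : ∃ c, c ∈ A := by
    obtain ⟨b, hb, hvb⟩ := hv.2 (form p q v)
    rcases Relation.ReflTransGen.cases_head hvb with rfl | ⟨c, hc, -⟩
    · exact absurd hb (lt_irrefl _)
    · exact ⟨c, Finset.mem_filter.2 ⟨hc.1, upperTerritory_closed hv hc.1 hc.2⟩⟩
  have hstate : IsState (φ + lap I) := by
    intro x
    simp only [Pi.add_apply]
    by_cases h1 : x = v
    · subst h1
      have h := lap_pos_of_mem hI0 (hAT c hc).1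
      rw [hIA c hc, hIv] at h
      rw [hv.1]
      omega
    · by_cases h2 : x ∈ A
      · have h := lap_pos_of_mem hI0 (nbrs_symm (hAT x h2).1)
        rw [hIA x h2, hIv] at h
        rw [(hAT x h2).2.1]
        omega
      · have h := lap_pos_of_mem hI0 (v := x) (w := (x.1 + 1, x.2)) (by simp [mem_nbrs])
        have := hI0 (x.1 + 1, x.2)
        have : 0 ≤ φ x := hθ.levelState_stable.1 x
        rw [hIn x h1 h2] at h
        omega
  set H : ℤ × ℤ → ℤ := (fun x => θ (form p q x - 1) + 1) - fun x => θ (form p q x) with hH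
  have hlapH : ∀ x, φ x + lap H x = φ (x - w) := by
    intro x
    rw [hH, lap_sub, lap_comp_form, lap_shift_comp_form]
    simp only [hφ, levelState, form_sub, hw]
    ring
  have hH01 : ∀ x, 0 ≤ H x ∧ H x ≤ 1 := by
    intro x
    have := hθ.slope_eq (form p q x)
    simp only [hH, Pi.sub_apply]
    omega
  have hHT : ∀ x ∈ T, H x = 1 := by
    intro x hx
    have := hθ.slope_zero_of_mem hx
    simp only [hH, Pi.sub_apply]
    omega
  have hIH : ∀ x, I x ≤ H x := by
    intro x
    by_cases h1 : x = v
    · rw [h1, hIv, hHT v hv]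
    · by_cases h2 : x ∈ A
      · rw [hIA x h2, hHT x (hAT x h2).2]
      · rw [hIn x h1 h2]; exact (hH01 x).1
  obtain ⟨u, hu0, huH, hu⟩ := exists_relaxation hstate (H := H - I)
    (fun x => sub_nonneg.2 (hIH x)) (fun x => by
      have := hlapH x
      have : φ (x - w) ≤ 3 := hθ.levelState_le (x - w)
      rw [lap_sub, Pi.add_apply]
      omega)
  have hstab : ∀ x, φ x + lap (u + I) x ≤ 3 := by
    intro x
    have := hu.2.1.2 x
    simp only [Pi.add_apply] at this
    rw [lap_add]
    omega
  have hle : ∀ x, (u + I) x ≤ H x := fun x => by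
    have := huH x
    simp only [Pi.add_apply, Pi.sub_apply] at *
    omega
  have h0 : ∀ x, 0 ≤ (u + I) x := fun x => add_nonneg (hu0 x) (hI0 x)
  -- Toppling spreads along `T`: a vertex with three grains and a toppled neighbour is unstable
  -- until it topples itself.
  have hone : ∀ x ∈ T, (u + I) x = 1 := by
    intro x hx
    have hvx := linked_upperTerritory hpq hR' hv hx
    clear hx
    induction hvx with
    | refl =>
      have := hle v
      have := hu0 v
      rw [hHT v hv] at *
      simp only [Pi.add_apply, hIv] at *
      omega
    | @tail y z _ hz ih =>
      have a1 := lap_pos_of_mem h0 (nbrs_symm hz.1)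
      have a2 := hstab z
      have a3 := hle z
      have a4 := (hH01 z).2
      have a5 := h0 z
      have a6 : φ z = 3 := hz.2
      omega
  have heq : u + I = H := by
    funext x
    refine le_antisymm (hle x) ?_
    have := hθ.wave_le hpq h0 (fun x => (hle x).trans (hH01 x).2) hone hstab x
    simp only [hH, Pi.sub_apply]
    omega
  convert hu using 1
  funext x
  rw [← hlapH x, ← heq, lap_add, Pi.add_apply]
  ring

/-- An infinite territory of the state of a profile is the upper or the lower one. -/
theorem eq_of_infinite (hθ : IsProfile p q θ) (hpq : IsCoprime p q) {T : Set (ℤ × ℤ)}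
    (hT : IsTerritory (levelState p q θ) T) (hinf : T.Infinite) :
    T = upperTerritory p q (levelState p q θ) ∨
      T = upperTerritory (-p) (-q) (levelState p q θ) := by
  obtain ⟨R, hR0, hR⟩ := hθ.exists_levelState_eq_three hpq
  by_cases h1 : ∃ v ∈ T, R < form p q v
  · obtain ⟨v, hv, hvR⟩ := h1
    exact Or.inl (hT.eq_upperTerritory hpq
      (fun v hv => hR v (lt_of_lt_of_le hv (le_abs_self _))) hv hvR)
  by_cases h2 : ∃ v ∈ T, form p q v < -R
  · obtain ⟨v, hv, hvR⟩ := h2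
    refine Or.inr (hT.eq_upperTerritory hpq.neg_neg (R := R)
      (fun v hv => hR v (lt_of_lt_of_le hv ?_)) hv ?_)
    · rw [form_neg_neg]; exact neg_le_abs _
    · rw [form_neg_neg]; omega
  exfalso
  push Not at h1 h2
  -- Infinitely many vertices lie on finitely many levels.
  obtain ⟨a, ha, b, hb, hne, hf⟩ := hinf.exists_ne_map_eq_of_mapsTo (f := form p q)
    (t := Set.Icc (-R) R) (fun v hv => ⟨h2 v hv, h1 v hv⟩) (Set.finite_Icc _ _)
  have hlink : ∀ {x y}, x ∈ T → y ∈ T → Linked T x y := fun hx hy =>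
    linked_of_connected hT.connected hx hy
  have hB := isBarrier_levels hpq (fun v hv => ⟨h2 v hv, h1 v hv⟩) ha (hlink ha hb) hne hf
  obtain ⟨e, he, he0, her⟩ := exists_steepest hpq
  have hge : ∀ n : ℤ, 0 ≤ n → n ≤ n * form p q e := fun n hn => by nlinarith
  rcases hθ.barrier_cases hpq hB ⟨_, a, ha, rfl⟩ (by
      rintro s ⟨x, hx, rfl⟩ t ⟨y, hy, rfl⟩
      exact levelPath_of_linked (hlink hx hy)) (by
      rintro s ⟨x, hx, rfl⟩
      exact levelState_eq_three_iff.1 (hT.eq_three x hx)) with ⟨m, ⟨v, hv, rfl⟩, hm⟩ |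
      ⟨m, ⟨v, hv, rfl⟩, hm⟩
  -- The profile is linear below `v`, so the ray from `v` in direction `-e` carries three grains
  -- throughout and leads `T` out of the strip.
  · have key : ∀ n : ℕ, v - n • e ∈ T := by
      intro n
      induction n with
      | zero => simpa using hv
      | succ n ih =>
        refine hT.mem_of_linked ih (Relation.ReflTransGen.single ⟨?_, ?_⟩)
        · refine nbrs_symm ?_
          convert he (v - (n + 1) • e) using 1
          rw [succ_nsmul]; abel
        · refine levelState_eq_three_iff.2 (levelLap_eq_zero_of_le her hm he0.le ?_)
          rw [form_sub, form_nsmul]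
          push_cast
          have : 0 ≤ n * form p q e := by positivity
          linarith
    have := h2 _ (key (form p q v + R + 1).toNat)
    rw [form_sub, form_nsmul] at this
    have h3 := hge (form p q v + R + 1).toNat (by omega)
    omega
  · have key : ∀ n : ℕ, v + n • e ∈ T := by
      intro n
      induction n with
      | zero => simpa using hv
      | succ n ih =>
        refine hT.mem_of_linked ih (Relation.ReflTransGen.single ⟨?_, ?_⟩)
        · convert he (v + n • e) using 1
          rw [succ_nsmul]; abel
        · refine levelState_eq_three_iff.2 ?_
          rw [← hθ.levelLap_neg]
          refine levelLap_eq_zero_of_le (m := -form p q v) her (fun s hs => ?_) he0.le ?_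
          · have := hθ.reflect (-s)
            rw [neg_neg, hm (-s) (by omega)] at this
            omega
          · rw [form_add, form_nsmul]
            push_cast
            have : 0 ≤ n * form p q e := by positivity
            linarith
    have := h1 _ (key (R - form p q v + 1).toNat)
    rw [form_add, form_nsmul] at this
    have h3 := hge (R - form p q v + 1).toNat (by omega)
    omega

end IsProfile

theorem IsPrimitiveVector.eq_or_eq_neg {α : Projectivization ℚ (ℚ × ℚ)} {p q a b : ℤ}
    (h : IsPrimitiveVector α p q) (h' : IsPrimitiveVector α a b) :
    (a = p ∧ b = q) ∨ (a = -p ∧ b = -q) := by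
  have hdet : a * q = b * p := by
    have h1 := h.2
    have h2 := h'.2
    rw [Projectivization.submodule_eq, Submodule.mem_span_singleton] at h1 h2
    obtain ⟨s, hs⟩ := h1
    obtain ⟨t, ht⟩ := h2
    have e1 := congrArg Prod.fst hs
    have e2 := congrArg Prod.snd hs
    have e3 := congrArg Prod.fst ht
    have e4 := congrArg Prod.snd ht
    simp only [Prod.smul_fst, Prod.smul_snd, smul_eq_mul] at e1 e2 e3 e4
    have : (a : ℚ) * q = b * p := by rw [← e1, ← e2, ← e3, ← e4]; ring
    exact_mod_cast this
  obtain ⟨x, y, hxy⟩ := h.1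
  obtain ⟨x', y', hxy'⟩ := h'.1
  have ha : a = (x * a + y * b) * p := by linear_combination -a * hxy + y * hdet
  have hb : b = (x * a + y * b) * q := by linear_combination -b * hxy - x * hdet
  have hunit : IsUnit (x * a + y * b) := by
    refine IsUnit.of_mul_eq_one (x' * p + y' * q) ?_
    linear_combination hxy' - x' * ha - y' * hb
  rcases Int.isUnit_iff.1 hunit with h | h
  · left
    rw [h] at ha hb
    omega
  · right
    rw [h] at ha hb
    omega

theorem toPlane_mem_thickening {p q : ℤ} (hpq : IsCoprime p q) (R : ℤ) :
    ∃ r : ℝ, ∀ v, |form p q v| ≤ R → toPlane v ∈ Metric.thickening r (line p q) := by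
  obtain ⟨a, b, hab⟩ := hpq
  refine ⟨R * ‖toPlane (b, -a)‖ + 1, fun v hv => ?_⟩
  rw [Metric.mem_thickening_iff]
  -- Coordinates in the lattice basis `(p, q)`, `(b, -a)`; the second one is the level.
  have hdec : toPlane v = ((a * v.1 + b * v.2 : ℤ) : ℝ) • toPlane (p, q) +
      ((form p q v : ℤ) : ℝ) • toPlane (b, -a) := by
    have h1 : v.1 = (a * v.1 + b * v.2) * p + form p q v * b := by
      simp only [form]; linear_combination -v.1 * hab
    have h2 : v.2 = (a * v.1 + b * v.2) * q + form p q v * -a := by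
      simp only [form]; linear_combination -v.2 * hab
    ext i
    fin_cases i
    · simpa [toPlane] using congrArg (Int.cast : ℤ → ℝ) h1
    · simpa [toPlane] using congrArg (Int.cast : ℤ → ℝ) h2
  refine ⟨((a * v.1 + b * v.2 : ℤ) : ℝ) • toPlane (p, q),
    Submodule.smul_mem _ _ (Submodule.mem_span_singleton_self _), ?_⟩
  rw [dist_eq_norm, hdec, add_sub_cancel_left, norm_smul, Real.norm_eq_abs, ← Int.cast_abs]
  have : ((|form p q v| : ℤ) : ℝ) ≤ R := by exact_mod_cast hv
  nlinarith [norm_nonneg (toPlane (b, -a))]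

theorem IsProfile.isSandSoliton {α : Projectivization ℚ (ℚ × ℚ)} {p q : ℤ} {θ : ℤ → ℤ}
    (hα : IsPrimitiveVector α p q) (hθ : IsProfile p q θ) :
    IsSandSoliton α (levelState p q θ) := by
  -- The only other primitive vector is `(-p, -q)`, for which `θ` is also the profile and gives the
  -- same state.
  have main : ∀ {P : ℤ → ℤ → Prop}, (∀ p' q', IsPrimitiveVector α p' q' → IsProfile p' q' θ →
      levelState p' q' θ = levelState p q θ → P p' q') →
      ∀ p' q', IsPrimitiveVector α p' q' → P p' q' := by
    intro P h p' q' hp'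
    rcases hα.eq_or_eq_neg hp' with ⟨rfl, rfl⟩ | ⟨rfl, rfl⟩
    · exact h _ _ hp' hθ rfl
    · exact h _ _ hp' hθ.neg hθ.levelState_neg_neg
  refine ⟨hθ.levelState_stable, hθ.levelState_neg, main ?_, main ?_, main ?_⟩
  · intro p' q' _ _ he v
    rw [← he, levelState, form_add, levelState]
    have : form p' q' (p', q') = 0 := by simp only [form]; ring
    rw [this, add_zero]
  · intro p' q' hp' hθ' he
    obtain ⟨R, -, hR⟩ := hθ'.exists_levelState_eq_three hp'.1
    obtain ⟨r, hr⟩ := toPlane_mem_thickening hp'.1 R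
    refine ⟨r, fun v hv => hr v (not_lt.1 fun h => ?_)⟩
    rw [← he, hR v h] at hv
    exact lt_irrefl _ hv
  · intro p' q' hp' hθ' he
    rw [← he]
    have hneg := neg_upperTerritory (p := p') (q := q') hθ'.levelState_neg
    have hterr : ∀ {p q : ℤ}, IsCoprime p q → IsProfile p q θ →
        IsTerritory (levelState p q θ) (upperTerritory p q (levelState p q θ)) ∧
        (upperTerritory p q (levelState p q θ)).Infinite := by
      intro p q hpq hθ
      obtain ⟨R, -, hR⟩ := hθ.exists_levelState_eq_three hpq
      have hR' : ∀ v, R < form p q v → levelState p q θ v = 3 := fun v hv =>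
        hR v (lt_of_lt_of_le hv (le_abs_self _))
      exact ⟨isTerritory_upperTerritory hpq hθ.levelState_le hR',
        upperTerritory_infinite hpq hR'⟩
    have hlow := (hterr hp'.1.neg_neg hθ'.neg).1
    rw [hθ'.levelState_neg_neg] at hlow
    refine ⟨upperTerritory p' q' (levelState p' q' θ), (hterr hp'.1 hθ').1, (hterr hp'.1 hθ').2,
      hneg ▸ hlow, fun T' hT' hinf => ?_, fun v hv => hθ'.form_pos_of_mem hp'.1 hv,
      fun v hv => ?_, fun a b hab => ⟨hθ'.waveEq hp'.1 hab, ?_⟩⟩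
    · rw [hneg]
      exact hθ'.eq_of_infinite hp'.1 hT' hinf
    · have := hθ'.form_pos_of_mem hp'.1 (Set.mem_neg.1 hv)
      rw [form_neg] at this
      omega
    · have := hθ'.neg.waveEq hp'.1.neg_neg (w := -(a, b)) (by
        rw [form_neg_neg, form_neg, hab, neg_neg])
      rw [hθ'.levelState_neg_neg, ← hneg] at this
      simpa only [sub_neg_eq_add] using this

end Sandpile

theorem mainTheorem7 (α : Projectivization ℚ (ℚ × ℚ)) :
    ∃ φ : ℤ × ℤ → ℤ, Sandpile.IsSandSoliton α φ := by
  obtain ⟨p, q, hα⟩ := Sandpile.exists_isPrimitiveVector α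
  obtain ⟨θ, hθ⟩ := Sandpile.exists_isProfile hα.1
  exact ⟨Sandpile.levelState p q θ, hθ.isSandSoliton hα⟩
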